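/- Let $M>0$ and $H\in\mathbb{R}$. Let $\tilde k_H(r)=-Hr^3+r^{3/2}(2M-r)^{1/2}$ for $0<r<2M$. Then $\tilde k_H$ attains its maximum $C_H$ over $(0,2M)$ at exactly one point $R_H$, and it is strictly increasing on $(0,R_H]$. Let II$'=\{(U,V): U>0,\ V<0,\ UV>-2M\}$ be the white-hole interior region of the Kruskal plane of Schwarzschild spacetime of mass $M$, whose points represent round spheres of radius $r\in(0,2M)$ with $UV=(r-2M)e^{r/2M}$; it has the Schwarzschild coordinates $(t,r)$ with $$U=e^{-\frac{1}{4M}(t-r-2M\ln|r-2M|)},\qquad V=-e^{\frac{1}{4M}(t+r+2M\ln|r-2M|)},$$ and time is oriented so that $r$ increases to the future. Put $h(r)=1-\frac{2M}{r}$ and $l_c(r)=\frac{1}{\sqrt{-h(r)}}\left(Hr+\frac{c}{r^2}\right)$. For $0<c<C_H$ let $\rho_c\in(0,R_H)$ be the solution of $\tilde k_H(\rho_c)=c$, and let $\tilde\Sigma^+_{H,c}$ be the spherically symmetric hypersurface that consists of all points of II$'$ with $$0<r\le\rho_c,\qquad t=\pm\int_{\rho_c}^{r}\frac{1}{-h(x)}\sqrt{\frac{l_c(x)^2}{l_c(x)^2-1}}\,dx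 .$$ For $c=C_H$ let $\tilde\Sigma^+_{H,C_H}$ be the cylindrical hypersurface $r=R_H$ in II$'$. Then each $\tilde\Sigma^+_{H,c}$, $0<c\le C_H$, is a smooth spacelike spherically symmetric hypersurface of constant mean curvature $H$ (one third of the trace of the second fundamental form with respect to the future unit normal), symmetric under $(U,V)\mapsto(-V,-U)$, and the family $\{\tilde\Sigma^+_{H,c}\}_{0<c\le C_H}$ forms a foliation of the part $0<r\le R_H$ of region II$'$: the hypersurfaces are connected, pairwise disjoint, their union is $\{0<r\le R_H\}\cap$ II$'$, and every point of this set has an open neighbourhood in the Kruskal plane with a homeomorphism onto an open rectangle under which each leaf that meets the neighbourhood becomes exactly one full horizontal segment. -/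

import Mathlib

open Set

noncomputable section

/-! ### Semi-Riemannian geometry of hypersurfaces in coordinates -/

/-- The partial derivative `∂ᵢ f` at `x`. -/
def pderiv {n : ℕ} (f : (Fin n → ℝ) → ℝ) (i : Fin n) (x : Fin n → ℝ) : ℝ :=
  deriv (fun s : ℝ => f (Function.update x i s)) (x i)

/-- The Christoffel symbol `Γᵐ_{ab}` of the metric `g` (given in coordinates). -/
def christoffel (g : (Fin 4 → ℝ) → Matrix (Fin 4) (Fin 4) ℝ) (x : Fin 4 → ℝ)
    (m a b : Fin 4) : ℝ :=
  (1 / 2) * ∑ s, (g x)⁻¹ m s *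
    (pderiv (fun y => g y s b) a x + pderiv (fun y => g y s a) b x - pderiv (fun y => g y a b) s x)

/-- First fundamental form (induced metric) of the parametrized hypersurface `F`. -/
def firstForm (g : (Fin 4 → ℝ) → Matrix (Fin 4) (Fin 4) ℝ) (F : (Fin 3 → ℝ) → Fin 4 → ℝ)
    (y : Fin 3 → ℝ) : Matrix (Fin 3) (Fin 3) ℝ :=
  Matrix.of fun i j => ∑ a, ∑ b,
    g (F y) a b * pderiv (fun z => F z a) i y * pderiv (fun z => F z b) j y

/-- `m`-th component of `∇_{∂ᵢF} ∂ⱼF`. -/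
def covDeriv (g : (Fin 4 → ℝ) → Matrix (Fin 4) (Fin 4) ℝ) (F : (Fin 3 → ℝ) → Fin 4 → ℝ)
    (y : Fin 3 → ℝ) (i j : Fin 3) (m : Fin 4) : ℝ :=
  pderiv (fun z => pderiv (fun w => F w m) j z) i y +
    ∑ a, ∑ b, christoffel g (F y) m a b *
      pderiv (fun z => F z a) i y * pderiv (fun z => F z b) j y

/-- Second fundamental form `K(∂ᵢ, ∂ⱼ) = ⟨∇ᵢ N, ∂ⱼ⟩ = -⟨N, ∇ᵢ ∂ⱼ⟩` with respect to the unit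
normal `N`. -/
def secondForm (g : (Fin 4 → ℝ) → Matrix (Fin 4) (Fin 4) ℝ) (F : (Fin 3 → ℝ) → Fin 4 → ℝ)
    (N : Fin 4 → ℝ) (y : Fin 3 → ℝ) : Matrix (Fin 3) (Fin 3) ℝ :=
  Matrix.of fun i j => -∑ a, ∑ b, g (F y) a b * N a * covDeriv g F y i j b

/-- Mean curvature: one third of the trace of the second fundamental form. -/
def meanCurvature (g : (Fin 4 → ℝ) → Matrix (Fin 4) (Fin 4) ℝ) (F : (Fin 3 → ℝ) → Fin 4 → ℝ)
    (N : Fin 4 → ℝ) (y : Fin 3 → ℝ) : ℝ :=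
  (1 / 3) * ((firstForm g F y)⁻¹ * secondForm g F N y).trace

/-! ### Region II' of the Kruskal extension -/

/-- The Schwarzschild metric of mass `M` in the coordinates `(t, r, θ, φ)`. -/
def schwarzschild (M : ℝ) (x : Fin 4 → ℝ) : Matrix (Fin 4) (Fin 4) ℝ :=
  Matrix.diagonal
    ![-(1 - 2 * M / x 1), (1 - 2 * M / x 1)⁻¹, x 1 ^ 2, x 1 ^ 2 * Real.sin (x 2) ^ 2]

/-- The coordinate change `(t, r) ↦ (U, V)` from the Schwarzschild interior `0 < r < 2M` onto
region II' (`U > 0`, `V < 0`) of the Kruskal plane: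
`U = exp (-u / 4M)`, `V = -exp (v / 4M)` with `u = t - r*`, `v = t + r*`,
`r* = r + 2M ln |r - 2M|`. It is an isometry for the Kruskal metric
`16 M² exp (-r / 2M) / r dU dV + r² dσ²`, where `U V = (r - 2M) exp (r / 2M)`. -/
def toKruskal (M t r : ℝ) : ℝ × ℝ :=
  (Real.exp (-(t - (r + 2 * M * Real.log |r - 2 * M|)) / (4 * M)),
   -Real.exp ((t + (r + 2 * M * Real.log |r - 2 * M|)) / (4 * M)))

/-- The part `0 < r ≤ R` of region II', as a subset of the Kruskal `(U, V)` plane (every point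
of the plane stands for a round sphere of radius `r`). -/
def regionIIprime (M R : ℝ) : Set (ℝ × ℝ) :=
  {p | 0 < p.1 ∧ p.2 < 0 ∧
    ∃ r ∈ Ioc 0 R, p.1 * p.2 = (r - 2 * M) * Real.exp (r / (2 * M))}

/-- The spherically symmetric hypersurface `r = g(t)` in Schwarzschild coordinates,
parametrized by `(t, θ, φ)`. -/
def sphGraph (g : ℝ → ℝ) (y : Fin 3 → ℝ) : Fin 4 → ℝ := ![y 0, g (y 0), y 1, y 2]

/-- `S`, a curve in region II' of the Kruskal plane, represents a smooth spacelike spherically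
symmetric hypersurface, symmetric with respect to the `T`-axis `U + V = 0`, with constant mean
curvature `H` for the future unit normal. In region II', `∂_T` points to increasing `r`, so a
timelike vector is future directed iff its `r`-component is positive. -/
def IsTSSCMC (M H : ℝ) (S : Set (ℝ × ℝ)) : Prop :=
  (∀ U V : ℝ, (U, V) ∈ S → (-V, -U) ∈ S) ∧
  ∃ (I : Set ℝ) (g : ℝ → ℝ), IsOpen I ∧ IsConnected I ∧
    ContDiffOn ℝ (⊤ : ℕ∞) g I ∧ (∀ t ∈ I, g t ∈ Ioo 0 (2 * M)) ∧
    S = (fun t => toKruskal M t (g t)) '' I ∧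
    ∀ y : Fin 3 → ℝ, y 0 ∈ I → y 1 ∈ Ioo 0 Real.pi →
      (firstForm (schwarzschild M) (sphGraph g) y).PosDef ∧
      ∃ N : Fin 4 → ℝ,
        (∑ a, ∑ b, schwarzschild M (sphGraph g y) a b * N a * N b) = -1 ∧
        (∀ i, (∑ a, ∑ b, schwarzschild M (sphGraph g y) a b * N a *
          pderiv (fun z => sphGraph g z b) i y) = 0) ∧
        0 < N 1 ∧
        meanCurvature (schwarzschild M) (sphGraph g) N y = H

/-! ### The family `Σ̃⁺_{H,c}` -/

/-- `k̃_H(r) = -H r³ + r^{3/2} (2M - r)^{1/2}`. -/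
def kTilde (M H r : ℝ) : ℝ := -H * r ^ 3 + Real.sqrt (r ^ 3 * (2 * M - r))

/-- `R` is a point of `(0, 2M)` where `k̃_H` attains its maximum over `(0, 2M)`. -/
def IsMaxRadius (M H R : ℝ) : Prop :=
  R ∈ Ioo 0 (2 * M) ∧ IsMaxOn (kTilde M H) (Ioo 0 (2 * M)) R

/-- `l(r) = (H r + c / r²) / √(-h(r))`, where `h(r) = 1 - 2M / r`. -/
def lFun (M H c r : ℝ) : ℝ := (H * r + c / r ^ 2) / Real.sqrt (-(1 - 2 * M / r))

/-- The height function `t = f(r) = ∫_ρ^r (1 / (-h)) √(l² / (l² - 1)) dx`. -/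
def height (M H c ρ r : ℝ) : ℝ :=
  ∫ x in ρ..r, 1 / (-(1 - 2 * M / x)) * Real.sqrt (lFun M H c x ^ 2 / (lFun M H c x ^ 2 - 1))

open Classical in
/-- The hypersurface `Σ̃⁺_{H,c}`, as a curve in the Kruskal plane; `R` is the point `R_H`, and
`C_H = k̃_H(R)`. For `c < C_H` it is the union of the curves `t = ± f(r)`, `0 < r ≤ ρ`, where `ρ`
solves `k̃_H(ρ) = c` on the increasing part `(0, R)` of `k̃_H` and `f(ρ) = 0`. For `c = C_H` it is
the cylindrical hypersurface `r = R`. -/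
def tssLeaf (M H R c : ℝ) : Set (ℝ × ℝ) :=
  if c = kTilde M H R then {p | ∃ t : ℝ, p = toKruskal M t R}
  else {p | ∃ ρ ∈ Ioo 0 R, kTilde M H ρ = c ∧ ∃ r ∈ Ioc 0 ρ,
    p = toKruskal M (height M H c ρ r) r ∨ p = toKruskal M (-height M H c ρ r) r}

/-! ### Foliations -/

/-- The curves `L c`, `c ∈ A`, foliate the subset `D` of the plane: they are nonempty, connected,
pairwise disjoint, fill up `D`, and near every point of `D` there is a chart of the plane onto an
open rectangle such that every leaf that meets the domain of the chart corresponds to exactly one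
full horizontal segment of the rectangle. -/
structure IsFoliation (D : Set (ℝ × ℝ)) (A : Set ℝ) (L : ℝ → Set (ℝ × ℝ)) : Prop where
  connected : ∀ c ∈ A, IsConnected (L c)
  disjoint : A.PairwiseDisjoint L
  cover : ⋃ c ∈ A, L c = D
  chart : ∀ p ∈ D, ∃ (φ : OpenPartialHomeomorph (ℝ × ℝ) (ℝ × ℝ)) (a₁ b₁ a₂ b₂ : ℝ),
    p ∈ φ.source ∧ φ.target = Ioo a₁ b₁ ×ˢ Ioo a₂ b₂ ∧
    ∀ c ∈ A, (L c ∩ φ.source).Nonempty →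
      ∃ y : ℝ, φ '' (L c ∩ φ.source) = Ioo a₁ b₁ ×ˢ {y}

end

/-!
Write `D(r) = r³ (2M - r)`, and let `m(r) = (3M - 2r) / √D` be three times the mean curvature of the
cylinder of radius `r`. Since `k̃_H' = r² (m - 3H)` and `m` decreases strictly from `+∞` to `-∞`, the
function `k̃_H` has exactly one critical point `R`, its maximum, and `r = R` is the only cylinder
of mean curvature `H`.

A leaf is labelled by the radius `ρ ∈ (0, R]` at which it meets `t = 0`, so `c = k̃_H(ρ)`. With
`A = H r³ + c`, the gap `A² - D` is `(ρ - r)` times a polynomial that is positive on `[0, ρ]`. In the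
parameter `w = ± √(ρ - r)` the time along the leaf becomes an odd smooth function with positive
derivative (`paramTime`); inverting it presents the leaf as a smooth graph `r = g(t)`, also at
`t = 0`, where the slope `dt/dr` is singular. This graph satisfies `(g')² = Q(g)` and
`g'' = Q'(g) / 2` for an explicit function `Q` (`leafRadius_ode`), and a computation with the
Christoffel symbols turns these equations into mean curvature `H` (`cmc_sphGraph`).

The foliation rests on the fact that the time `Φ(r, ρ)` a leaf needs to get from `ρ` to `r` is
strictly increasing in `ρ` (`leafTime_lt_leafTime`). The integrand of `Φ` is singular at the moving
endpoint `ρ`, and it decreases in `c`, so this is not visible directly. In the variable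
`y = √D / A`, which runs over `(0, 1)` on every leaf, the integral becomes

  `∫ √(r / (2M - r)) / (y √(1 - y²) (m(r) - 3 H y)) dy`,

and for fixed `y` the integrand increases with `r`, while the outer leaf has the larger `r` at the
same `y`. Moreover `Φ(r, ρ)` is continuous in `ρ` and tends to infinity as `ρ → R`, because `R` is a
double root of the gap and the leaf slope dominates `k / (R - r)`. So each point below `R` lies on
exactly one leaf. At fixed `t` the radius is a strictly increasing continuous function of `ρ`, and
`(t, ρ)` are foliation coordinates; beyond `R` the leaves are continued by the cylinders `r = ρ`
to obtain charts around the boundary leaf.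
-/

open Filter Topology

noncomputable section

variable {M H R ρ x : ℝ}

/-! ### The profile function -/

/-- The quartic `r³ (2M - r)` under the square root in `k̃_H`. -/
def quartic (M x : ℝ) : ℝ := x ^ 3 * (2 * M - x)

/-- Three times the mean curvature of the cylinder of radius `x`: the function `m` for which
`k̃_H' = x² (m - 3H)`. -/
def cylCurv (M x : ℝ) : ℝ := (3 * M - 2 * x) / √(quartic M x)

lemma quartic_pos (hx : x ∈ Ioo 0 (2 * M)) : 0 < quartic M x :=
  mul_pos (pow_pos hx.1 3) (by linarith [hx.2])

lemma hasDerivAt_quartic (M x : ℝ) :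
    HasDerivAt (quartic M) (x ^ 2 * (6 * M - 4 * x)) x := by
  have := ((hasDerivAt_id x).pow 3).mul ((hasDerivAt_id x).const_sub (2 * M))
  refine this.congr_deriv ?_
  simp; ring

lemma hasDerivAt_sqrt_quartic (hx : x ∈ Ioo 0 (2 * M)) :
    HasDerivAt (fun x => √(quartic M x)) (x ^ 2 * cylCurv M x) x := by
  have h := quartic_pos hx
  refine ((hasDerivAt_quartic M x).sqrt h.ne').congr_deriv ?_
  have := Real.sqrt_pos.2 h
  unfold cylCurv
  field_simp
  ring

lemma kTilde_eq (M H x : ℝ) : kTilde M H x = -H * x ^ 3 + √(quartic M x) := rfl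

lemma hasDerivAt_kTilde (H : ℝ) (hx : x ∈ Ioo 0 (2 * M)) :
    HasDerivAt (kTilde M H) (x ^ 2 * (cylCurv M x - 3 * H)) x := by
  have := (((hasDerivAt_id x).pow 3).const_mul (-H)).add (hasDerivAt_sqrt_quartic hx)
  refine this.congr_deriv ?_
  simp; ring

lemma continuous_kTilde (M H : ℝ) : Continuous (kTilde M H) := by
  unfold kTilde; fun_prop

lemma kTilde_zero (M H : ℝ) : kTilde M H 0 = 0 := by simp [kTilde]

lemma cylCurv_strictAntiOn (M : ℝ) : StrictAntiOn (cylCurv M) (Ioo 0 (2 * M)) := by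
  have hd : ∀ x ∈ Ioo 0 (2 * M), HasDerivAt (cylCurv M)
      ((-2 * √(quartic M x) - (3 * M - 2 * x) * (x ^ 2 * cylCurv M x)) / √(quartic M x) ^ 2) x := by
    intro x hx
    have h1 : HasDerivAt (fun x => 3 * M - 2 * x) (-2) x := by
      simpa using ((hasDerivAt_id x).const_mul 2).const_sub (3 * M)
    exact h1.div (hasDerivAt_sqrt_quartic hx) (Real.sqrt_pos.2 (quartic_pos hx)).ne'
  refine strictAntiOn_of_deriv_neg (convex_Ioo _ _)
    (fun x hx => (hd x hx).continuousAt.continuousWithinAt) fun x hx => ?_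
  rw [interior_Ioo] at hx
  rw [(hd x hx).deriv]
  have hs := Real.sqrt_pos.2 (quartic_pos hx)
  refine div_neg_of_neg_of_pos ?_ (by positivity)
  have : (3 * M - 2 * x) * (x ^ 2 * cylCurv M x) = x ^ 2 * (3 * M - 2 * x) ^ 2 / √(quartic M x) := by
    unfold cylCurv; ring
  rw [this]
  have : 0 ≤ x ^ 2 * (3 * M - 2 * x) ^ 2 / √(quartic M x) := by positivity
  linarith

lemma continuousOn_cylCurv (M : ℝ) : ContinuousOn (cylCurv M) (Ioo 0 (2 * M)) := by
  refine ContinuousOn.div (by fun_prop) (by unfold quartic; fun_prop) fun x hx => ?_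
  exact (Real.sqrt_pos.2 (quartic_pos hx)).ne'

/-- Since `m` decreases from `+∞` to `-∞` on `(0, 2M)`, there is a cylinder of mean
curvature `H`. -/
lemma exists_cylCurv_eq (hM : 0 < M) (H : ℝ) : ∃ R ∈ Ioo 0 (2 * M), cylCurv M R = 3 * H := by
  have key : ∀ a, quartic M a = 0 →
      Tendsto (fun x => (√(quartic M x))⁻¹) (𝓝[Ioo 0 (2 * M)] a) atTop := by
    intro a h0
    refine Tendsto.inv_tendsto_nhdsGT_zero (tendsto_nhdsWithin_iff.2 ⟨?_, ?_⟩)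
    · have : Continuous fun x => √(quartic M x) := by unfold quartic; fun_prop
      simpa [h0] using (this.tendsto a).mono_left nhdsWithin_le_nhds
    · filter_upwards [self_mem_nhdsWithin] with x hx using Real.sqrt_pos.2 (quartic_pos hx)
  have lin : ∀ a, Tendsto (fun x => 3 * M - 2 * x) (𝓝[Ioo 0 (2 * M)] a) (𝓝 (3 * M - 2 * a)) :=
    fun a => ((by fun_prop : Continuous fun x : ℝ => 3 * M - 2 * x).tendsto a).mono_left
      nhdsWithin_le_nhds
  have h0 : Tendsto (cylCurv M) (𝓝[Ioo 0 (2 * M)] 0) atTop := by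
    refine Tendsto.pos_mul_atTop (C := 3 * M - 2 * 0) (by linarith) (lin 0)
      (key 0 (by simp [quartic]))
  have h1 : Tendsto (cylCurv M) (𝓝[Ioo 0 (2 * M)] (2 * M)) atBot := by
    refine Tendsto.neg_mul_atTop (C := 3 * M - 2 * (2 * M)) (by linarith) (lin (2 * M))
      (key (2 * M) (by simp [quartic]))
  have hlt : (0 : ℝ) < 2 * M := by linarith
  have : (𝓝[Ioo 0 (2 * M)] (0 : ℝ)).NeBot := by
    rw [nhdsWithin_Ioo_eq_nhdsGT hlt]; infer_instance
  have : (𝓝[Ioo 0 (2 * M)] (2 * M)).NeBot := by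
    rw [nhdsWithin_Ioo_eq_nhdsLT hlt]; infer_instance
  obtain ⟨a, ha, ha'⟩ := ((h0.eventually_ge_atTop (3 * H)).and self_mem_nhdsWithin).exists
  obtain ⟨b, hb, hb'⟩ := ((h1.eventually_le_atBot (3 * H)).and self_mem_nhdsWithin).exists
  exact isPreconnected_Ioo.intermediate_value hb' ha' (continuousOn_cylCurv M) ⟨hb, ha⟩

/-- `R` is the critical radius: the cylinder `r = R` has mean curvature `H`. -/
def IsCritRadius (M H R : ℝ) : Prop := R ∈ Ioo 0 (2 * M) ∧ cylCurv M R = 3 * H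

lemma IsCritRadius.lt_cylCurv (hR : IsCritRadius M H R) (h0 : 0 < x) (hx : x < R) :
    3 * H < cylCurv M x :=
  hR.2 ▸ cylCurv_strictAntiOn M ⟨h0, hx.trans hR.1.2⟩ hR.1 hx

lemma IsCritRadius.strictMonoOn (hR : IsCritRadius M H R) :
    StrictMonoOn (kTilde M H) (Icc 0 R) := by
  refine strictMonoOn_of_deriv_pos (convex_Icc _ _) (continuous_kTilde M H).continuousOn
    fun x hx => ?_
  rw [interior_Icc] at hx
  rw [(hasDerivAt_kTilde H ⟨hx.1, hx.2.trans hR.1.2⟩).deriv]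
  exact mul_pos (pow_pos hx.1 2) (sub_pos.2 (hR.lt_cylCurv hx.1 hx.2))

lemma IsCritRadius.strictAntiOn (hR : IsCritRadius M H R) :
    StrictAntiOn (kTilde M H) (Ico R (2 * M)) := by
  refine strictAntiOn_of_deriv_neg (convex_Ico _ _) (continuous_kTilde M H).continuousOn
    fun x hx => ?_
  rw [interior_Ico] at hx
  have h0 : 0 < x := hR.1.1.trans hx.1
  rw [(hasDerivAt_kTilde H ⟨h0, hx.2⟩).deriv]
  have := cylCurv_strictAntiOn M hR.1 ⟨h0, hx.2⟩ hx.1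
  rw [hR.2] at this
  exact mul_neg_of_pos_of_neg (pow_pos h0 2) (sub_neg.2 this)

lemma IsCritRadius.kTilde_lt (hR : IsCritRadius M H R) (hx : x ∈ Ioo 0 (2 * M)) (hne : x ≠ R) :
    kTilde M H x < kTilde M H R := by
  rcases lt_or_gt_of_ne hne with h | h
  · exact hR.strictMonoOn ⟨hx.1.le, h.le⟩ ⟨hR.1.1.le, le_rfl⟩ h
  · exact hR.strictAntiOn ⟨le_rfl, hR.1.2⟩ ⟨h.le, hx.2⟩ h

lemma IsCritRadius.isMaxRadius (hR : IsCritRadius M H R) : IsMaxRadius M H R := by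
  refine ⟨hR.1, fun x hx => ?_⟩
  by_cases h : x = R
  · simp [h]
  · exact (hR.kTilde_lt hx h).le

lemma IsCritRadius.eq_of_isMaxRadius (hR : IsCritRadius M H R) {R' : ℝ}
    (h : IsMaxRadius M H R') : R' = R := by
  by_contra hne
  exact (hR.kTilde_lt h.1 hne).not_ge (h.2 hR.1)

lemma IsCritRadius.kTilde_pos (hR : IsCritRadius M H R) (hρ : ρ ∈ Ioc 0 R) :
    0 < kTilde M H ρ :=
  kTilde_zero M H ▸ hR.strictMonoOn ⟨le_rfl, hR.1.1.le⟩ ⟨hρ.1.le, hρ.2⟩ hρ.1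

lemma IsCritRadius.exists_kTilde_eq (hR : IsCritRadius M H R) {c : ℝ}
    (hc : c ∈ Ioo 0 (kTilde M H R)) : ∃ ρ ∈ Ioo 0 R, kTilde M H ρ = c := by
  have := intermediate_value_Ioo hR.1.1.le (continuous_kTilde M H).continuousOn
  rw [kTilde_zero] at this
  exact this hc

/-! ### The flux through a leaf and the reduced gap -/

/-- The quantity `H r³ + c`, where `c = k̃_H(ρ)`; it equals `r² Nʳ` for the unit normal `N` of the
leaf that meets the axis `t = 0` at radius `ρ`. -/
def flux (M H ρ x : ℝ) : ℝ := H * x ^ 3 + kTilde M H ρ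

/-- The quotient of `flux ^ 2 - quartic` by its root factor `ρ - r`. -/
def redGap (M H ρ x : ℝ) : ℝ :=
  2 * M * (ρ ^ 2 + ρ * x + x ^ 2) - (ρ ^ 3 + ρ ^ 2 * x + ρ * x ^ 2 + x ^ 3)
    - H * (ρ ^ 2 + ρ * x + x ^ 2) * (flux M H ρ x + √(quartic M ρ))

lemma flux_self (M H ρ : ℝ) : flux M H ρ ρ = √(quartic M ρ) := by
  rw [flux, kTilde_eq]; ring

lemma flux_sq_sub_quartic (hρ : ρ ∈ Ioo 0 (2 * M)) (x : ℝ) :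
    flux M H ρ x ^ 2 - quartic M x = (ρ - x) * redGap M H ρ x := by
  have hs := Real.sq_sqrt (quartic_pos hρ).le
  rw [redGap, flux, kTilde_eq]
  generalize √(quartic M ρ) = s at *
  unfold quartic at *
  linear_combination hs

lemma IsCritRadius.mem_Ioo (hR : IsCritRadius M H R) (hρ : ρ ∈ Ioo 0 R) : ρ ∈ Ioo 0 (2 * M) :=
  ⟨hρ.1, hρ.2.trans hR.1.2⟩

lemma sqrt_quartic_lt_flux (hR : IsCritRadius M H R) (hρ : ρ ∈ Ioo 0 R) (hx : x ∈ Ico 0 ρ) :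
    √(quartic M x) < flux M H ρ x := by
  have := hR.strictMonoOn ⟨hx.1, (hx.2.trans hρ.2).le⟩ ⟨hρ.1.le, hρ.2.le⟩ hx.2
  rw [kTilde_eq M H x] at this
  unfold flux
  linarith

lemma flux_pos (hR : IsCritRadius M H R) (hρ : ρ ∈ Ioo 0 R) (hx : x ∈ Icc 0 ρ) :
    0 < flux M H ρ x := by
  rcases hx.2.eq_or_lt with rfl | h
  · rw [flux_self]; exact Real.sqrt_pos.2 (quartic_pos (hR.mem_Ioo hρ))
  · exact (Real.sqrt_nonneg _).trans_lt (sqrt_quartic_lt_flux hR hρ ⟨hx.1, h⟩)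

lemma quartic_lt_flux_sq (hR : IsCritRadius M H R) (hρ : ρ ∈ Ioo 0 R) (hx : x ∈ Ico 0 ρ) :
    quartic M x < flux M H ρ x ^ 2 :=
  (Real.sqrt_lt' (flux_pos hR hρ ⟨hx.1, hx.2.le⟩)).1 (sqrt_quartic_lt_flux hR hρ hx)

/-- At `r = ρ` the value is a positive multiple of `k̃_H'(ρ)`: the root `ρ` of
`flux ^ 2 - quartic` is simple as long as `ρ` is below the critical radius. -/
lemma redGap_pos (hR : IsCritRadius M H R) (hρ : ρ ∈ Ioo 0 R) (hx : x ∈ Icc 0 ρ) :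
    0 < redGap M H ρ x := by
  rcases hx.2.eq_or_lt with rfl | h
  · have hs := Real.sqrt_pos.2 (quartic_pos (hR.mem_Ioo hρ))
    have hm := hR.lt_cylCurv hρ.1 hρ.2
    rw [cylCurv, lt_div_iff₀ hs] at hm
    have : redGap M H x x = 2 * x ^ 2 * (3 * M - 2 * x - 3 * H * √(quartic M x)) := by
      rw [redGap, flux_self]; ring
    rw [this]
    exact mul_pos (by have := hρ.1; positivity) (by linarith)
  · have h1 := flux_sq_sub_quartic (H := H) (hR.mem_Ioo hρ) x
    have h2 := quartic_lt_flux_sq hR hρ ⟨hx.1, h⟩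
    exact pos_of_mul_pos_right (h1 ▸ sub_pos.2 h2) (sub_nonneg.2 hx.2)

/-! ### The time function of a leaf in the variable `w = ± √(ρ - r)` -/

/-- The regular part of the slope of a leaf: along it, `dt = ± J(r) dr / √(ρ - r)` with this
function `J`. -/
def recipSpeed (M H ρ x : ℝ) : ℝ :=
  x * flux M H ρ x / ((2 * M - x) * √(redGap M H ρ x))

/-- The time along the leaf as a function of the uniformizing parameter `w = ± √(ρ - r)`. -/
def paramTime (M H ρ w : ℝ) : ℝ := ∫ s in (0)..w, 2 * recipSpeed M H ρ (ρ - s ^ 2)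

/-- The time `|t|` at which the leaf through `(t, r) = (0, ρ)` reaches the radius `r`. -/
def leafTime (M H ρ x : ℝ) : ℝ := paramTime M H ρ √(ρ - x)

lemma recipSpeed_pos (hR : IsCritRadius M H R) (hρ : ρ ∈ Ioo 0 R) (hx : x ∈ Ioc 0 ρ) :
    0 < recipSpeed M H ρ x := by
  have h1 := flux_pos hR hρ ⟨hx.1.le, hx.2⟩
  have h2 := Real.sqrt_pos.2 (redGap_pos hR hρ ⟨hx.1.le, hx.2⟩)
  have h3 : 0 < 2 * M - x := by linarith [hx.2, hρ.2, hR.1.2]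
  exact div_pos (mul_pos hx.1 h1) (mul_pos h3 h2)

lemma contDiffAt_recipSpeed (hR : IsCritRadius M H R) (hρ : ρ ∈ Ioo 0 R) (hx : x ∈ Icc 0 ρ) :
    ContDiffAt ℝ (⊤ : ℕ∞) (recipSpeed M H ρ) x := by
  have h2 := redGap_pos hR hρ hx
  have h3 : 0 < 2 * M - x := by linarith [hx.2, hρ.2, hR.1.2]
  have h4 : ContDiffAt ℝ (⊤ : ℕ∞) (redGap M H ρ) x := by unfold redGap flux; fun_prop
  have h5 : ContDiffAt ℝ (⊤ : ℕ∞) (fun x => x * flux M H ρ x) x := by unfold flux; fun_prop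
  refine h5.div (ContDiffAt.mul (by fun_prop) (h4.sqrt h2.ne')) ?_
  exact (mul_pos h3 (Real.sqrt_pos.2 h2)).ne'

/-- The parameter interval on which the radius `ρ - w²` is positive. -/
def paramDom (ρ : ℝ) : Set ℝ := Ioo (-√ρ) √ρ

lemma mem_paramDom {w : ℝ} : w ∈ paramDom ρ ↔ w ^ 2 < ρ := by
  rw [paramDom, mem_Ioo, ← abs_lt, Real.lt_sqrt (abs_nonneg w), sq_abs]

lemma radius_mem {w : ℝ} (hw : w ∈ paramDom ρ) : ρ - w ^ 2 ∈ Ioc 0 ρ :=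
  ⟨sub_pos.2 (mem_paramDom.1 hw), by linarith [sq_nonneg w]⟩

lemma contDiffOn_recipSpeed_comp (hR : IsCritRadius M H R) (hρ : ρ ∈ Ioo 0 R) :
    ContDiffOn ℝ (⊤ : ℕ∞) (fun w => 2 * recipSpeed M H ρ (ρ - w ^ 2)) (paramDom ρ) := by
  intro w hw
  have h := contDiffAt_recipSpeed hR hρ (Ioc_subset_Icc_self (radius_mem hw))
  exact (contDiffAt_const.mul (h.comp w (f := fun w => ρ - w ^ 2)
    (by fun_prop))).contDiffWithinAt

lemma hasDerivAt_paramTime (hR : IsCritRadius M H R) (hρ : ρ ∈ Ioo 0 R) {w : ℝ}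
    (hw : w ∈ paramDom ρ) :
    HasDerivAt (paramTime M H ρ) (2 * recipSpeed M H ρ (ρ - w ^ 2)) w := by
  have hc := (contDiffOn_recipSpeed_comp hR hρ).continuousOn
  have hsub : uIcc 0 w ⊆ paramDom ρ := by
    have h0 : (0 : ℝ) ∈ paramDom ρ := mem_paramDom.2 (by simpa using hρ.1)
    exact ordConnected_Ioo.uIcc_subset h0 hw
  exact intervalIntegral.integral_hasDerivAt_right (hc.mono hsub).intervalIntegrable
    (hc.stronglyMeasurableAtFilter isOpen_Ioo w hw) (hc.continuousAt (isOpen_Ioo.mem_nhds hw))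

lemma contDiffOn_paramTime (hR : IsCritRadius M H R) (hρ : ρ ∈ Ioo 0 R) :
    ContDiffOn ℝ (⊤ : ℕ∞) (paramTime M H ρ) (paramDom ρ) := by
  refine (contDiffOn_infty_iff_deriv_of_isOpen isOpen_Ioo).2
    ⟨fun w hw => (hasDerivAt_paramTime hR hρ hw).differentiableAt.differentiableWithinAt, ?_⟩
  exact (contDiffOn_recipSpeed_comp hR hρ).congr fun w hw => (hasDerivAt_paramTime hR hρ hw).deriv

lemma strictMonoOn_paramTime (hR : IsCritRadius M H R) (hρ : ρ ∈ Ioo 0 R) :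
    StrictMonoOn (paramTime M H ρ) (paramDom ρ) := by
  refine strictMonoOn_of_deriv_pos (convex_Ioo _ _) (contDiffOn_paramTime hR hρ).continuousOn
    fun w hw => ?_
  have hw : w ∈ paramDom ρ := interior_subset hw
  rw [(hasDerivAt_paramTime hR hρ hw).deriv]
  exact mul_pos two_pos (recipSpeed_pos hR hρ (radius_mem hw))

lemma paramTime_zero (M H ρ : ℝ) : paramTime M H ρ 0 = 0 := by simp [paramTime]

lemma paramTime_neg (M H ρ w : ℝ) : paramTime M H ρ (-w) = -paramTime M H ρ w := by
  have := intervalIntegral.integral_comp_neg (a := 0) (b := w)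
    (fun s => 2 * recipSpeed M H ρ (ρ - s ^ 2))
  simp only [neg_sq, neg_zero] at this
  rw [paramTime, paramTime, this, intervalIntegral.integral_symm]

lemma sqrt_mem_paramDom (hx : x ∈ Ioc 0 ρ) : √(ρ - x) ∈ paramDom ρ := by
  rw [mem_paramDom, Real.sq_sqrt (sub_nonneg.2 hx.2)]
  linarith [hx.1]

lemma abs_paramTime (hR : IsCritRadius M H R) (hρ : ρ ∈ Ioo 0 R) {w : ℝ} (hw : w ∈ paramDom ρ) :
    |paramTime M H ρ w| = leafTime M H ρ (ρ - w ^ 2) := by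
  have h0 : (0 : ℝ) ∈ paramDom ρ := mem_paramDom.2 (by simpa using hρ.1)
  have hm := (strictMonoOn_paramTime hR hρ).monotoneOn
  rw [leafTime, sub_sub_cancel, Real.sqrt_sq_eq_abs]
  rcases le_total 0 w with h | h
  · rw [abs_of_nonneg h, abs_of_nonneg]
    simpa [paramTime_zero] using hm h0 hw h
  · rw [abs_of_nonpos h, paramTime_neg, abs_of_nonpos]
    simpa [paramTime_zero] using hm hw h0 h

lemma leafTime_self (M H ρ : ℝ) : leafTime M H ρ ρ = 0 := by simp [leafTime, paramTime_zero]

lemma continuousOn_leafTime (hR : IsCritRadius M H R) (hρ : ρ ∈ Ioo 0 R) :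
    ContinuousOn (leafTime M H ρ) (Ioc 0 ρ) :=
  (contDiffOn_paramTime hR hρ).continuousOn.comp (by fun_prop) fun _ => sqrt_mem_paramDom

lemma strictAntiOn_leafTime (hR : IsCritRadius M H R) (hρ : ρ ∈ Ioo 0 R) :
    StrictAntiOn (leafTime M H ρ) (Ioc 0 ρ) := fun a ha b hb hab =>
  strictMonoOn_paramTime hR hρ (sqrt_mem_paramDom hb) (sqrt_mem_paramDom ha)
    (Real.sqrt_lt_sqrt (sub_nonneg.2 hb.2) (by linarith))

lemma leafTime_nonneg (hR : IsCritRadius M H R) (hρ : ρ ∈ Ioo 0 R) (hx : x ∈ Ioc 0 ρ) :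
    0 ≤ leafTime M H ρ x :=
  leafTime_self M H ρ ▸ (strictAntiOn_leafTime hR hρ).antitoneOn hx ⟨hρ.1, le_rfl⟩ hx.2

/-- The slope `|dt/dr|` of a leaf. -/
def leafSlope (M H ρ x : ℝ) : ℝ :=
  x * flux M H ρ x / ((2 * M - x) * √(flux M H ρ x ^ 2 - quartic M x))

lemma hasDerivAt_leafTime (hR : IsCritRadius M H R) (hρ : ρ ∈ Ioo 0 R) (hx : x ∈ Ioo 0 ρ) :
    HasDerivAt (leafTime M H ρ) (-leafSlope M H ρ x) x := by
  have hx' : x ∈ Ioc 0 ρ := ⟨hx.1, hx.2.le⟩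
  have h0 : 0 < ρ - x := sub_pos.2 hx.2
  have h1 := hasDerivAt_paramTime hR hρ (sqrt_mem_paramDom hx')
  have h2 : HasDerivAt (fun x => √(ρ - x)) (-1 / (2 * √(ρ - x))) x :=
    ((hasDerivAt_id x).const_sub ρ).sqrt h0.ne'
  refine (h1.comp x h2).congr_deriv ?_
  have h3 := Real.sqrt_pos.2 (redGap_pos hR hρ ⟨hx.1.le, hx.2.le⟩)
  have h4 := Real.sqrt_pos.2 h0
  have h5 : 0 < 2 * M - x := by linarith [hx.2, hρ.2, hR.1.2]
  rw [Real.sq_sqrt h0.le, sub_sub_cancel, leafSlope, flux_sq_sub_quartic (hR.mem_Ioo hρ),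
    Real.sqrt_mul h0.le, recipSpeed]
  field_simp

lemma leafSlope_pos (hR : IsCritRadius M H R) (hρ : ρ ∈ Ioo 0 R) (hx : x ∈ Ioo 0 ρ) :
    0 < leafSlope M H ρ x := by
  have h1 := flux_pos hR hρ ⟨hx.1.le, hx.2.le⟩
  have h2 := Real.sqrt_pos.2 (sub_pos.2 (quartic_lt_flux_sq hR hρ ⟨hx.1.le, hx.2⟩))
  have h3 : 0 < 2 * M - x := by linarith [hx.2, hρ.2, hR.1.2]
  exact div_pos (mul_pos hx.1 h1) (mul_pos h3 h2)

lemma intervalIntegrable_leafSlope (hR : IsCritRadius M H R) (hρ : ρ ∈ Ioo 0 R)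
    (hx : x ∈ Ioc 0 ρ) : IntervalIntegrable (leafSlope M H ρ) MeasureTheory.volume x ρ := by
  refine intervalIntegral.intervalIntegrable_deriv_of_nonneg (g := fun y => -leafTime M H ρ y)
    ?_ ?_ ?_
  · rw [uIcc_of_le hx.2]
    exact (continuousOn_leafTime hR hρ).neg.mono fun y hy => ⟨hx.1.trans_le hy.1, hy.2⟩
  all_goals
    rw [min_eq_left hx.2, max_eq_right hx.2]
    intro y hy
  · simpa using (hasDerivAt_leafTime hR hρ ⟨hx.1.trans hy.1, hy.2⟩).fun_neg
  · exact (leafSlope_pos hR hρ ⟨hx.1.trans hy.1, hy.2⟩).le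

lemma integral_leafSlope (hR : IsCritRadius M H R) (hρ : ρ ∈ Ioo 0 R) (hx : x ∈ Ioc 0 ρ) :
    ∫ y in x..ρ, leafSlope M H ρ y = leafTime M H ρ x := by
  rw [intervalIntegral.integral_eq_sub_of_hasDerivAt_of_le (f := fun y => -leafTime M H ρ y) hx.2
    ?_ ?_ (intervalIntegrable_leafSlope hR hρ hx)]
  · simp [leafTime_self]
  · exact (continuousOn_leafTime hR hρ).neg.mono fun y hy => ⟨hx.1.trans_le hy.1, hy.2⟩
  · intro y hy
    simpa using (hasDerivAt_leafTime hR hρ ⟨hx.1.trans hy.1, hy.2⟩).fun_neg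

/-- The integrand of `height` in terms of polynomials under one square root. -/
lemma height_integrand_eq (hR : IsCritRadius M H R) (hρ : ρ ∈ Ioo 0 R) (hx : x ∈ Ioo 0 ρ) :
    1 / (-(1 - 2 * M / x)) * √(lFun M H (kTilde M H ρ) x ^ 2 /
      (lFun M H (kTilde M H ρ) x ^ 2 - 1)) = leafSlope M H ρ x := by
  have hx0 := hx.1
  have h1 := flux_pos hR hρ ⟨hx.1.le, hx.2.le⟩
  have h2 : 0 < flux M H ρ x ^ 2 - quartic M x :=
    sub_pos.2 (quartic_lt_flux_sq hR hρ ⟨hx.1.le, hx.2⟩)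
  have h3 : 0 < 2 * M - x := by linarith [hx.2, hρ.2, hR.1.2]
  have h4 : -(1 - 2 * M / x) = (2 * M - x) / x := by field_simp; ring
  have h5 : lFun M H (kTilde M H ρ) x ^ 2 = flux M H ρ x ^ 2 / quartic M x := by
    rw [lFun, h4, div_pow, Real.sq_sqrt (by positivity), quartic,
      show H * x + kTilde M H ρ / x ^ 2 = flux M H ρ x / x ^ 2 by unfold flux; field_simp]
    field_simp
  have hq : 0 < quartic M x := quartic_pos ⟨hx.1, by linarith⟩
  have h6 : flux M H ρ x ^ 2 / quartic M x / (flux M H ρ x ^ 2 / quartic M x - 1) =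
      flux M H ρ x ^ 2 / (flux M H ρ x ^ 2 - quartic M x) := by
    rw [div_sub_one hq.ne']; field_simp
  rw [h4, h5, h6, Real.sqrt_div (by positivity), Real.sqrt_sq h1.le, leafSlope]
  field_simp

lemma height_eq (hR : IsCritRadius M H R) (hρ : ρ ∈ Ioo 0 R) (hx : x ∈ Ioc 0 ρ) :
    height M H (kTilde M H ρ) ρ x = -leafTime M H ρ x := by
  rw [height, intervalIntegral.integral_symm, ← integral_leafSlope hR hρ hx]
  congr 1
  rw [intervalIntegral.integral_of_le hx.2, intervalIntegral.integral_of_le hx.2,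
    MeasureTheory.integral_Ioc_eq_integral_Ioo, MeasureTheory.integral_Ioc_eq_integral_Ioo]
  exact MeasureTheory.setIntegral_congr_fun measurableSet_Ioo fun y hy =>
    height_integrand_eq hR hρ ⟨hx.1.trans hy.1, hy.2⟩

/-! ### The leaf as a smooth graph over the time axis -/

/-- The inverse of an injective smooth function of one real variable with nonvanishing
derivative is smooth. -/
lemma contDiffOn_invFunOn {f f' : ℝ → ℝ} {S : Set ℝ} (hS : IsOpen S) (hinj : InjOn f S)
    (hf : ContDiffOn ℝ (⊤ : ℕ∞) f S) (hd : ∀ x ∈ S, HasDerivAt f (f' x) x)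
    (h0 : ∀ x ∈ S, f' x ≠ 0) :
    IsOpen (f '' S) ∧ ContDiffOn ℝ (⊤ : ℕ∞) (Function.invFunOn f S) (f '' S) ∧
      ∀ x ∈ S, HasDerivAt (Function.invFunOn f S) (f' x)⁻¹ (f x) := by
  have hmap : ∀ x ∈ S, map f (𝓝 x) = 𝓝 (f x) := fun x hx =>
    (((hf.contDiffAt (hS.mem_nhds hx)).hasStrictDerivAt' (hd x hx) (by simp)).map_nhds_eq (h0 x hx))
  have hopen : IsOpenMap (S.domRestrict f) := by
    refine isOpenMap_iff_nhds_le.2 fun x => ?_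
    rw [domRestrict_apply, ← hmap x x.2, domRestrict_eq, ← Filter.map_map,
      map_nhds_subtype_coe_eq_nhds x.2 (hS.mem_nhds x.2)]
  let e : OpenPartialHomeomorph ℝ ℝ :=
    OpenPartialHomeomorph.ofContinuousOpenRestrict (hinj.toPartialEquiv f S)
      hf.continuousOn hopen hS
  have hinv : ∀ x ∈ S, e.symm (f x) = x := fun x hx => e.left_inv hx
  refine ⟨e.open_target, fun y hy => ?_, fun x hx => ?_⟩
  · obtain ⟨x, hx, rfl⟩ := hy
    refine ContDiffAt.contDiffWithinAt (e.contDiffAt_symm_deriv (f₀' := f' x) (h0 x hx)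
      (e.map_source hx) ?_ ?_)
    · rw [hinv x hx]; exact hd x hx
    · rw [hinv x hx]; exact hf.contDiffAt (hS.mem_nhds hx)
  · refine e.hasDerivAt_symm (e.map_source hx) (h0 x hx) ?_
    rw [hinv x hx]; exact hd x hx

/-- The time interval over which the leaf through `(t, r) = (0, ρ)` is a graph. -/
def leafDomain (M H ρ : ℝ) : Set ℝ := paramTime M H ρ '' paramDom ρ

/-- The uniformizing parameter `w` as a function of time. -/
def leafParam (M H ρ : ℝ) : ℝ → ℝ := Function.invFunOn (paramTime M H ρ) (paramDom ρ)

/-- The radius of the leaf through `(t, r) = (0, ρ)` as a function of time. -/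
def leafRadius (M H ρ t : ℝ) : ℝ := ρ - leafParam M H ρ t ^ 2

section
variable (hR : IsCritRadius M H R) (hρ : ρ ∈ Ioo 0 R)
include hR hρ

lemma leafParam_smooth : IsOpen (leafDomain M H ρ) ∧
    ContDiffOn ℝ (⊤ : ℕ∞) (leafParam M H ρ) (leafDomain M H ρ) ∧
      ∀ w ∈ paramDom ρ, HasDerivAt (leafParam M H ρ) (2 * recipSpeed M H ρ (ρ - w ^ 2))⁻¹
        (paramTime M H ρ w) :=
  contDiffOn_invFunOn isOpen_Ioo (strictMonoOn_paramTime hR hρ).injOn (contDiffOn_paramTime hR hρ)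
    (fun _ hw => hasDerivAt_paramTime hR hρ hw)
    fun _ hw => (mul_pos two_pos (recipSpeed_pos hR hρ (radius_mem hw))).ne'

lemma leafParam_paramTime {w : ℝ} (hw : w ∈ paramDom ρ) :
    leafParam M H ρ (paramTime M H ρ w) = w :=
  (strictMonoOn_paramTime hR hρ).injOn.leftInvOn_invFunOn hw

lemma isConnected_leafDomain : IsConnected (leafDomain M H ρ) := by
  have h0 : (0 : ℝ) ∈ paramDom ρ := mem_paramDom.2 (by simpa using hρ.1)
  exact ((isConnected_Ioo (nonempty_Ioo.1 ⟨0, h0⟩))).image _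
    (contDiffOn_paramTime hR hρ).continuousOn

lemma contDiffOn_leafRadius : ContDiffOn ℝ (⊤ : ℕ∞) (leafRadius M H ρ) (leafDomain M H ρ) :=
  contDiffOn_const.sub ((leafParam_smooth hR hρ).2.1.pow 2)

/-- The graph of `leafRadius` is the union of the two curves `t = ± leafTime`. -/
lemma mem_leafDomain_and_iff {t : ℝ} : t ∈ leafDomain M H ρ ∧ leafRadius M H ρ t = x ↔
    x ∈ Ioc 0 ρ ∧ |t| = leafTime M H ρ x := by
  constructor
  · rintro ⟨⟨w, hw, rfl⟩, rfl⟩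
    rw [leafRadius, leafParam_paramTime hR hρ hw]
    exact ⟨radius_mem hw, abs_paramTime hR hρ hw⟩
  · rintro ⟨hx, ht⟩
    have hw := sqrt_mem_paramDom hx
    have hsq : √(ρ - x) ^ 2 = ρ - x := Real.sq_sqrt (sub_nonneg.2 hx.2)
    rcases eq_or_eq_neg_of_abs_eq ht with rfl | rfl
    · refine ⟨⟨_, hw, rfl⟩, ?_⟩
      rw [leafRadius, leafTime, leafParam_paramTime hR hρ hw, hsq, sub_sub_cancel]
    · have hw' : -√(ρ - x) ∈ paramDom ρ := by rwa [mem_paramDom, neg_sq, ← mem_paramDom]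
      rw [leafTime, ← paramTime_neg]
      refine ⟨⟨_, hw', rfl⟩, ?_⟩
      rw [leafRadius, leafParam_paramTime hR hρ hw', neg_sq, hsq, sub_sub_cancel]

end

/-- The square of the coordinate speed `dr/dt` of a constant mean curvature graph with constant of
integration `c`, as a function of its radius. -/
def speedSq (M H c x : ℝ) : ℝ := ((2 * M - x) / x) ^ 2 * (1 - quartic M x / (H * x ^ 3 + c) ^ 2)

section
variable (hR : IsCritRadius M H R) (hρ : ρ ∈ Ioo 0 R)
include hR hρ

lemma speedSq_eventuallyEq (hx : x ∈ Ioc 0 ρ) :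
    speedSq M H (kTilde M H ρ) =ᶠ[𝓝 x] fun y => (ρ - y) / recipSpeed M H ρ y ^ 2 := by
  have hx2 : x < 2 * M := by linarith [hx.2, hρ.2, hR.1.2]
  have c1 : ContinuousAt (redGap M H ρ) x := by unfold redGap flux; fun_prop
  have c2 : ContinuousAt (flux M H ρ) x := by unfold flux; fun_prop
  filter_upwards [Ioo_mem_nhds hx.1 hx2,
    c1.eventually (lt_mem_nhds (redGap_pos hR hρ (Ioc_subset_Icc_self hx))),
    c2.eventually (lt_mem_nhds (flux_pos hR hρ (Ioc_subset_Icc_self hx)))] with y hy hp hA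
  have h3 : 0 < 2 * M - y := by linarith [hy.2]
  have h4 := hy.1
  have hgap := flux_sq_sub_quartic (H := H) (hR.mem_Ioo hρ) y
  have h5 : 1 - quartic M y / flux M H ρ y ^ 2 =
      (ρ - y) * redGap M H ρ y / flux M H ρ y ^ 2 := by
    rw [← hgap, one_sub_div (by positivity)]
  have hp' : √(redGap M H ρ y) ^ 2 = redGap M H ρ y := Real.sq_sqrt hp.le
  have hp0 := Real.sqrt_pos.2 hp
  rw [speedSq, ← flux, h5, recipSpeed]
  field_simp
  rw [hp']

lemma hasDerivAt_leafRadius {w : ℝ} (hw : w ∈ paramDom ρ) :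
    HasDerivAt (leafRadius M H ρ) (-w / recipSpeed M H ρ (ρ - w ^ 2)) (paramTime M H ρ w) := by
  have hJ := recipSpeed_pos hR hρ (radius_mem hw)
  refine ((((leafParam_smooth hR hρ).2.2 w hw).pow 2).const_sub ρ).congr_deriv ?_
  rw [leafParam_paramTime hR hρ hw]
  simp only [Nat.cast_ofNat, Nat.add_one_sub_one, pow_one, mul_inv]
  field_simp

/-- The graph function satisfies `(r')² = Q(r)` and `r'' = Q'(r) / 2`. The second equation does not
follow from the first at `t = 0`, where `r' = 0`; it is derived in the parameter `w`. -/
lemma leafRadius_ode {t : ℝ} (ht : t ∈ leafDomain M H ρ) :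
    deriv (leafRadius M H ρ) t ^ 2 = speedSq M H (kTilde M H ρ) (leafRadius M H ρ t) ∧
    HasDerivAt (speedSq M H (kTilde M H ρ)) (2 * deriv (deriv (leafRadius M H ρ)) t)
      (leafRadius M H ρ t) := by
  obtain ⟨w, hw, rfl⟩ := ht
  have hx := radius_mem hw
  have hJ := recipSpeed_pos hR hρ hx
  have hr : leafRadius M H ρ (paramTime M H ρ w) = ρ - w ^ 2 := by
    rw [leafRadius, leafParam_paramTime hR hρ hw]
  have hev := speedSq_eventuallyEq hR hρ hx
  have hdJ := ((contDiffAt_recipSpeed hR hρ (Ioc_subset_Icc_self hx)).differentiableAt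
    (by simp)).hasDerivAt
  have hg := hasDerivAt_leafRadius hR hρ hw
  have hw' := (leafParam_smooth hR hρ).2.2 w hw
  have hev' : deriv (leafRadius M H ρ) =ᶠ[𝓝 (paramTime M H ρ w)]
      fun t => -leafParam M H ρ t / recipSpeed M H ρ (leafRadius M H ρ t) := by
    filter_upwards [(leafParam_smooth hR hρ).1.mem_nhds ⟨w, hw, rfl⟩] with t ht
    obtain ⟨v, hv, rfl⟩ := ht
    rw [(hasDerivAt_leafRadius hR hρ hv).deriv, leafRadius, leafParam_paramTime hR hρ hv]
  set J := recipSpeed M H ρ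
  have hd2 : HasDerivAt (fun t => -leafParam M H ρ t / J (leafRadius M H ρ t)) _ _ :=
    hw'.fun_neg.fun_div
      (HasDerivAt.comp (paramTime M H ρ w) (h₂ := J) (by rw [hr]; exact hdJ) hg)
      (by rw [hr]; exact hJ.ne')
  rw [hr, hev.eq_of_nhds, hev'.deriv_eq, hd2.deriv, hg.deriv]
  refine ⟨by rw [sub_sub_cancel, div_pow, neg_sq], ?_⟩
  refine HasDerivAt.congr_of_eventuallyEq ?_ hev
  refine (((hasDerivAt_id _).const_sub ρ).fun_div (hdJ.fun_pow 2) (by positivity)).congr_deriv ?_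
  simp only [hr, leafParam_paramTime hR hρ hw, id]
  simp only [Nat.cast_ofNat, Nat.add_one_sub_one, pow_one, mul_inv]
  change _ = 2 * ((-(2⁻¹ * (J (ρ - w ^ 2))⁻¹) * J (ρ - w ^ 2) - _) / _)
  field_simp
  ring

end

/-! ### Monotonicity of the time function in the leaf -/

/-- The ratio `√(r³ (2M - r)) / (H r³ + c)`, which increases from `0` to `1` along the leaf and
serves as the common variable in which different leaves are compared. -/
def fluxRatio (M H ρ x : ℝ) : ℝ := √(quartic M x) / flux M H ρ x

/-- The function `√(r / (2M - r))`. -/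
def interiorWeight (M x : ℝ) : ℝ := √(x / (2 * M - x))

lemma interiorWeight_strictMonoOn (M : ℝ) : StrictMonoOn (interiorWeight M) (Ioo 0 (2 * M)) := by
  intro a ha b hb hab
  refine Real.sqrt_lt_sqrt (div_nonneg ha.1.le (by linarith [ha.2])) ?_
  have := ha.1
  exact div_lt_div₀ hab (by linarith) hb.1.le (by linarith [hb.2])

lemma interiorWeight_pos (hx : x ∈ Ioo 0 (2 * M)) : 0 < interiorWeight M x :=
  Real.sqrt_pos.2 (div_pos hx.1 (by linarith [hx.2]))

lemma sqrt_quartic_eq (hx : x ∈ Ioo 0 (2 * M)) :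
    √(quartic M x) = interiorWeight M x * (x * (2 * M - x)) := by
  have h1 := hx.1
  have h3 : 0 < 2 * M - x := by linarith [hx.2]
  rw [← Real.sqrt_sq (by positivity : 0 ≤ x * (2 * M - x)), interiorWeight,
    ← Real.sqrt_mul (by positivity), quartic]
  congr 1
  field_simp

section
variable (hR : IsCritRadius M H R) (hρ : ρ ∈ Ioo 0 R)
include hR hρ

lemma fluxRatio_self : fluxRatio M H ρ ρ = 1 := by
  rw [fluxRatio, flux_self]
  exact div_self (Real.sqrt_pos.2 (quartic_pos (hR.mem_Ioo hρ))).ne'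

lemma fluxRatio_pos (hx : x ∈ Ioc 0 ρ) : 0 < fluxRatio M H ρ x :=
  div_pos (Real.sqrt_pos.2 (quartic_pos ⟨hx.1, by linarith [hx.2, hρ.2, hR.1.2]⟩))
    (flux_pos hR hρ (Ioc_subset_Icc_self hx))

lemma fluxRatio_lt_one (hx : x ∈ Ioo 0 ρ) : fluxRatio M H ρ x < 1 :=
  (div_lt_one (flux_pos hR hρ (Ioo_subset_Icc_self hx))).2
    (sqrt_quartic_lt_flux hR hρ (Ioo_subset_Ico_self hx))

/-- This quantity controls the sign of the derivative of `fluxRatio`. For `H < 0` and `r > 3M/2`,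
where `m < 0`, positivity follows from positivity at `r = ρ`, because `r³ (3M - r) / (2r - 3M)` is
decreasing there. -/
lemma cylCurv_sub_fluxRatio_pos (hx : x ∈ Ioo 0 ρ) :
    0 < cylCurv M x - 3 * H * fluxRatio M H ρ x := by
  have hx2 : x ∈ Ioo 0 (2 * M) := ⟨hx.1, by linarith [hx.2, hρ.2, hR.1.2]⟩
  have hy0 := fluxRatio_pos hR hρ ⟨hx.1, hx.2.le⟩
  have hs := Real.sqrt_pos.2 (quartic_pos hx2)
  rcases le_or_gt 0 H with hH | hH
  · have h1 := hR.lt_cylCurv hx.1 (hx.2.trans hρ.2)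
    have h2 := mul_le_of_le_one_right (by positivity : 0 ≤ 3 * H) (fluxRatio_lt_one hR hρ hx).le
    linarith
  rcases le_or_gt x (3 * M / 2) with hx3 | hx3
  · have h1 : 0 ≤ cylCurv M x := div_nonneg (by linarith) hs.le
    have h2 := mul_neg_of_neg_of_pos hH hy0
    linarith
  have hA := flux_pos hR hρ (Ioo_subset_Icc_self hx)
  have hsq : √(quartic M x) ^ 2 = quartic M x := Real.sq_sqrt (quartic_pos hx2).le
  have hρs := Real.sqrt_pos.2 (quartic_pos (hR.mem_Ioo hρ))
  have hρsq : √(quartic M ρ) ^ 2 = quartic M ρ := Real.sq_sqrt (quartic_pos (hR.mem_Ioo hρ)).le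
  have hmρ := hR.lt_cylCurv hρ.1 hρ.2
  rw [cylCurv, lt_div_iff₀ hρs] at hmρ
  have hM : 0 < M := by linarith [hx2.1, hx2.2]
  set c := kTilde M H ρ with hc
  -- the claim at `ρ`, cleared of denominators
  have hPρ : c * (2 * ρ - 3 * M) < -H * (ρ ^ 3 * (3 * M - ρ)) := by
    have : H * (ρ ^ 3 * (ρ - 3 * M)) + c * (3 * M - 2 * ρ) =
        √(quartic M ρ) * (3 * M - 2 * ρ - 3 * H * √(quartic M ρ)) := by
      rw [hc, kTilde_eq]
      unfold quartic at *
      linear_combination (3 * H) * hρsq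
    have := this.symm ▸ mul_pos hρs (by linarith :
      0 < 3 * M - 2 * ρ - 3 * H * √(quartic M ρ))
    linarith
  have hcmp : ρ ^ 3 * (3 * M - ρ) * (2 * x - 3 * M) ≤ x ^ 3 * (3 * M - x) * (2 * ρ - 3 * M) := by
    have ha : 0 < x - 3 * M / 2 := by linarith
    have hb : 0 < ρ - x := by linarith [hx.2]
    have hb' : 0 < ρ - 3 * M / 2 := by linarith
    have : x ^ 3 * (3 * M - x) * (2 * ρ - 3 * M) - ρ ^ 3 * (3 * M - ρ) * (2 * x - 3 * M) =
        2 * (ρ - x) * ((3 * M / 2) ^ 4 + (x - 3 * M / 2) * (ρ - 3 * M / 2) *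
          (3 * M * ((x - 3 * M / 2) + (ρ - 3 * M / 2)) + (x - 3 * M / 2) ^ 2 +
            (x - 3 * M / 2) * (ρ - 3 * M / 2) + (ρ - 3 * M / 2) ^ 2)) := by ring
    have h2 : 0 ≤ 2 * (ρ - x) * ((3 * M / 2) ^ 4 + (x - 3 * M / 2) * (ρ - 3 * M / 2) *
          (3 * M * ((x - 3 * M / 2) + (ρ - 3 * M / 2)) + (x - 3 * M / 2) ^ 2 +
            (x - 3 * M / 2) * (ρ - 3 * M / 2) + (ρ - 3 * M / 2) ^ 2)) := by positivity
    linarith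
  have hP : c * (2 * x - 3 * M) < -H * (x ^ 3 * (3 * M - x)) := by
    have h2ρ : 0 < 2 * ρ - 3 * M := by linarith [hx.2]
    have h2x : 0 < 2 * x - 3 * M := by linarith
    refine lt_of_mul_lt_mul_right ?_ h2ρ.le
    calc c * (2 * x - 3 * M) * (2 * ρ - 3 * M) = c * (2 * ρ - 3 * M) * (2 * x - 3 * M) := by ring
      _ < -H * (ρ ^ 3 * (3 * M - ρ)) * (2 * x - 3 * M) := mul_lt_mul_of_pos_right hPρ h2x
      _ = -H * (ρ ^ 3 * (3 * M - ρ) * (2 * x - 3 * M)) := by ring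
      _ ≤ -H * (x ^ 3 * (3 * M - x) * (2 * ρ - 3 * M)) :=
        mul_le_mul_of_nonneg_left hcmp (by linarith)
      _ = _ := by ring
  have : cylCurv M x - 3 * H * fluxRatio M H ρ x =
      (-H * (x ^ 3 * (3 * M - x)) - c * (2 * x - 3 * M)) / (√(quartic M x) * flux M H ρ x) := by
    rw [cylCurv, fluxRatio]
    field_simp
    rw [hsq, flux, quartic]
    ring
  rw [this]
  exact div_pos (sub_pos.2 hP) (mul_pos hs hA)

lemma hasDerivAt_fluxRatio (hx : x ∈ Ioo 0 ρ) : HasDerivAt (fluxRatio M H ρ)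
    (x ^ 2 * (cylCurv M x - 3 * H * fluxRatio M H ρ x) / flux M H ρ x) x := by
  have hx2 : x ∈ Ioo 0 (2 * M) := ⟨hx.1, by linarith [hx.2, hρ.2, hR.1.2]⟩
  have hA := flux_pos hR hρ (Ioo_subset_Icc_self hx)
  have h1 : HasDerivAt (flux M H ρ) (H * (3 * x ^ 2)) x := by
    refine ((((hasDerivAt_id x).fun_pow 3).const_mul H).add_const (kTilde M H ρ)).congr_deriv ?_
    simp
  refine ((hasDerivAt_sqrt_quartic hx2).div h1 hA.ne').congr_deriv ?_
  unfold fluxRatio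
  field_simp

lemma continuousOn_fluxRatio : ContinuousOn (fluxRatio M H ρ) (Icc 0 ρ) := by
  refine ContinuousOn.div (by unfold quartic; fun_prop) (by unfold flux; fun_prop)
    fun x hx => (flux_pos hR hρ hx).ne'

lemma deriv_fluxRatio_pos (hx : x ∈ Ioo 0 ρ) :
    0 < x ^ 2 * (cylCurv M x - 3 * H * fluxRatio M H ρ x) / flux M H ρ x :=
  div_pos (mul_pos (pow_pos hx.1 2) (cylCurv_sub_fluxRatio_pos hR hρ hx))
    (flux_pos hR hρ (Ioo_subset_Icc_self hx))

lemma strictMonoOn_fluxRatio : StrictMonoOn (fluxRatio M H ρ) (Icc 0 ρ) := by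
  refine strictMonoOn_of_deriv_pos (convex_Icc _ _) (continuousOn_fluxRatio hR hρ) fun x hx => ?_
  rw [interior_Icc] at hx
  rw [(hasDerivAt_fluxRatio hR hρ hx).deriv]
  exact deriv_fluxRatio_pos hR hρ hx

lemma image_fluxRatio (hx : x ∈ Ico 0 ρ) :
    fluxRatio M H ρ '' Ioo x ρ = Ioo (fluxRatio M H ρ x) 1 := by
  have hsub : Icc x ρ ⊆ Icc 0 ρ := Icc_subset_Icc_left hx.1
  have hm := (strictMonoOn_fluxRatio hR hρ).mono hsub
  rw [← fluxRatio_self hR hρ]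
  refine Subset.antisymm ?_ (intermediate_value_Ioo hx.2.le
    ((continuousOn_fluxRatio hR hρ).mono hsub))
  rintro _ ⟨y, hy, rfl⟩
  exact ⟨hm ⟨le_rfl, hx.2.le⟩ ⟨hy.1.le, hy.2.le⟩ hy.1, hm ⟨hy.1.le, hy.2.le⟩ ⟨hx.2.le, le_rfl⟩ hy.2⟩

/-- The radius on the leaf at which the flux ratio takes the value `y`. -/
def ratioRadius (M H ρ : ℝ) : ℝ → ℝ := Function.invFunOn (fluxRatio M H ρ) (Ioo 0 ρ)

end

/-- The density of the leaf time with respect to the flux ratio `y`, at radius `x`. -/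
def ratioDensity (M H x y : ℝ) : ℝ :=
  interiorWeight M x / (y * √(1 - y ^ 2) * (cylCurv M x - 3 * H * y))

/-- With the flux ratio frozen, the density increases with the radius. -/
lemma ratioDensity_le {a b y : ℝ} (ha : 0 < a) (hab : a ≤ b) (hb : b < 2 * M) (hy0 : 0 < y)
    (hy1 : y < 1) (hpos : 0 < cylCurv M b - 3 * H * y) :
    ratioDensity M H a y ≤ ratioDensity M H b y := by
  have ha' : a ∈ Ioo 0 (2 * M) := ⟨ha, hab.trans_lt hb⟩
  have hb' : b ∈ Ioo 0 (2 * M) := ⟨ha.trans_le hab, hb⟩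
  have h1 := (interiorWeight_strictMonoOn M).monotoneOn ha' hb' hab
  have h2 := (cylCurv_strictAntiOn M).antitoneOn ha' hb' hab
  have h3 : 0 < √(1 - y ^ 2) := Real.sqrt_pos.2 (by nlinarith)
  have h4 := (interiorWeight_pos hb').le
  unfold ratioDensity
  gcongr

section
variable (hR : IsCritRadius M H R) (hρ : ρ ∈ Ioo 0 R)
include hR hρ

lemma leafSlope_eq (hx : x ∈ Ioo 0 ρ) : leafSlope M H ρ x =
    x ^ 2 * (cylCurv M x - 3 * H * fluxRatio M H ρ x) / flux M H ρ x *
      ratioDensity M H x (fluxRatio M H ρ x) := by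
  have hx2 : x ∈ Ioo 0 (2 * M) := ⟨hx.1, by linarith [hx.2, hρ.2, hR.1.2]⟩
  have hA := flux_pos hR hρ (Ioo_subset_Icc_self hx)
  have hm := cylCurv_sub_fluxRatio_pos hR hρ hx
  have hy := fluxRatio_pos hR hρ ⟨hx.1, hx.2.le⟩
  have hq := quartic_pos hx2
  have hE : 0 < flux M H ρ x ^ 2 - quartic M x :=
    sub_pos.2 (quartic_lt_flux_sq hR hρ ⟨hx.1.le, hx.2⟩)
  have h1 : √(1 - fluxRatio M H ρ x ^ 2) =
      √(flux M H ρ x ^ 2 - quartic M x) / flux M H ρ x := by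
    rw [fluxRatio, div_pow, Real.sq_sqrt hq.le, one_sub_div (by positivity),
      Real.sqrt_div hE.le, Real.sqrt_sq hA.le]
  have h2 : fluxRatio M H ρ x * flux M H ρ x = interiorWeight M x * (x * (2 * M - x)) := by
    rw [← sqrt_quartic_eq hx2, fluxRatio]; field_simp
  have hs := Real.sqrt_pos.2 hE
  have hw := interiorWeight_pos hx2
  have hx0 := hx.1
  have h3 : 0 < 2 * M - x := by linarith [hx2.2]
  rw [leafSlope, ratioDensity, h1]
  field_simp
  linear_combination h2

/-- The leaf time as an integral over the flux ratio. -/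
lemma leafTime_eq_integral_ratio (hx : x ∈ Ioo 0 ρ) :
    MeasureTheory.IntegrableOn (fun y => ratioDensity M H (ratioRadius M H ρ y) y)
      (Ioo (fluxRatio M H ρ x) 1) ∧
    leafTime M H ρ x =
      ∫ y in Ioo (fluxRatio M H ρ x) 1, ratioDensity M H (ratioRadius M H ρ y) y := by
  have hsub : Ioo x ρ ⊆ Ioo 0 ρ := Ioo_subset_Ioo_left hx.1.le
  have hinj : InjOn (fluxRatio M H ρ) (Ioo 0 ρ) :=
    (strictMonoOn_fluxRatio hR hρ).injOn.mono Ioo_subset_Icc_self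
  have hd : ∀ y ∈ Ioo x ρ, HasDerivWithinAt (fluxRatio M H ρ) _ (Ioo x ρ) y :=
    fun y hy => (hasDerivAt_fluxRatio hR hρ (hsub hy)).hasDerivWithinAt
  have hcongr : EqOn (leafSlope M H ρ) (fun z =>
      |z ^ 2 * (cylCurv M z - 3 * H * fluxRatio M H ρ z) / flux M H ρ z| •
        ratioDensity M H (ratioRadius M H ρ (fluxRatio M H ρ z)) (fluxRatio M H ρ z))
      (Ioo x ρ) := by
    intro z hz
    simp only
    rw [abs_of_pos (deriv_fluxRatio_pos hR hρ (hsub hz)), ratioRadius,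
      hinj.leftInvOn_invFunOn (hsub hz), leafSlope_eq hR hρ (hsub hz), smul_eq_mul]
  rw [← image_fluxRatio hR hρ ⟨hx.1.le, hx.2⟩,
    MeasureTheory.integrableOn_image_iff_integrableOn_abs_deriv_smul measurableSet_Ioo hd
      (hinj.mono hsub),
    MeasureTheory.integral_image_eq_integral_abs_deriv_smul measurableSet_Ioo hd (hinj.mono hsub)]
  constructor
  · refine MeasureTheory.IntegrableOn.congr_fun ?_ hcongr measurableSet_Ioo
    exact ((intervalIntegrable_iff_integrableOn_Ioc_of_le hx.2.le).1
      (intervalIntegrable_leafSlope hR hρ ⟨hx.1, hx.2.le⟩)).mono_set Ioo_subset_Ioc_self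
  · rw [← integral_leafSlope hR hρ ⟨hx.1, hx.2.le⟩, intervalIntegral.integral_of_le hx.2.le,
      MeasureTheory.integral_Ioc_eq_integral_Ioo]
    exact MeasureTheory.setIntegral_congr_fun measurableSet_Ioo hcongr

lemma ratioRadius_spec {y : ℝ} (hy : y ∈ Ioo 0 1) :
    ratioRadius M H ρ y ∈ Ioo 0 ρ ∧ fluxRatio M H ρ (ratioRadius M H ρ y) = y := by
  have h := image_fluxRatio hR hρ (x := 0) ⟨le_rfl, hρ.1⟩
  have h0 : fluxRatio M H ρ 0 = 0 := by simp [fluxRatio, quartic]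
  rw [h0] at h
  exact Function.invFunOn_pos (h.symm ▸ hy : y ∈ fluxRatio M H ρ '' Ioo 0 ρ)

end

lemma flux_lt_flux (hR : IsCritRadius M H R) {ρ₁ ρ₂ : ℝ} (h₁ : 0 < ρ₁) (h : ρ₁ < ρ₂)
    (h₂ : ρ₂ ≤ R) (x : ℝ) : flux M H ρ₁ x < flux M H ρ₂ x := by
  have := hR.strictMonoOn ⟨h₁.le, (h.trans_le h₂).le⟩ ⟨(h₁.trans h).le, h₂⟩ h
  unfold flux
  linarith

/-- Leaves that start at a larger radius take longer to reach a given radius. Compared at equal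
flux ratio, the outer leaf sits at a larger radius, where the density is larger. -/
lemma leafTime_lt_leafTime (hR : IsCritRadius M H R) {ρ₁ ρ₂ : ℝ} (h₂ : ρ₂ ∈ Ioo 0 R)
    (h : ρ₁ < ρ₂) (hx : x ∈ Ioc 0 ρ₁) : leafTime M H ρ₁ x < leafTime M H ρ₂ x := by
  have h₁ : ρ₁ ∈ Ioo 0 R := ⟨hx.1.trans_le hx.2, h.trans h₂.2⟩
  rcases hx.2.eq_or_lt with rfl | hlt
  · rw [leafTime_self, ← leafTime_self M H ρ₂]
    exact strictAntiOn_leafTime hR h₂ ⟨hx.1, h.le⟩ ⟨h₂.1, le_rfl⟩ h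
  have hx' : x ∈ Ioo 0 ρ₁ := ⟨hx.1, hlt⟩
  have hratio : ∀ z ∈ Ioo 0 ρ₁, fluxRatio M H ρ₂ z < fluxRatio M H ρ₁ z := fun z hz =>
    div_lt_div_of_pos_left (Real.sqrt_pos.2 (quartic_pos ⟨hz.1, by
      linarith [hz.2, h₁.2, hR.1.2]⟩)) (flux_pos hR h₁ (Ioo_subset_Icc_self hz))
      (flux_lt_flux hR h₁.1 h h₂.2.le z)
  have hrad : ∀ y ∈ Ioo 0 1, ratioRadius M H ρ₁ y < ratioRadius M H ρ₂ y := by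
    intro y hy
    obtain ⟨m1, e1⟩ := ratioRadius_spec hR h₁ hy
    obtain ⟨m2, e2⟩ := ratioRadius_spec hR h₂ hy
    by_contra! hle
    have h3 := hratio _ ⟨m2.1, hle.trans_lt m1.2⟩
    have h4 := (strictMonoOn_fluxRatio hR h₁).monotoneOn
      ⟨m2.1.le, (hle.trans_lt m1.2).le⟩ (Ioo_subset_Icc_self m1) hle
    linarith
  have hy : fluxRatio M H ρ₁ x ∈ Ioo 0 1 :=
    ⟨fluxRatio_pos hR h₁ hx, fluxRatio_lt_one hR h₁ hx'⟩
  obtain ⟨m2, e2⟩ := ratioRadius_spec hR h₂ hy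
  obtain ⟨i1, r1⟩ := leafTime_eq_integral_ratio hR h₁ hx'
  obtain ⟨i2, r2⟩ := leafTime_eq_integral_ratio hR h₂ m2
  rw [e2] at i2 r2
  have hxlt : x < ratioRadius M H ρ₂ (fluxRatio M H ρ₁ x) := by
    by_contra! hle
    have h3 := hratio x hx'
    have h4 := (strictMonoOn_fluxRatio hR h₂).monotoneOn (Ioo_subset_Icc_self m2)
      ⟨hx.1.le, (hlt.trans h).le⟩ hle
    linarith
  calc leafTime M H ρ₁ x ≤ leafTime M H ρ₂ (ratioRadius M H ρ₂ (fluxRatio M H ρ₁ x)) := by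
        rw [r1, r2]
        refine MeasureTheory.setIntegral_mono_on i1 i2 measurableSet_Ioo fun y hy' => ?_
        have hy01 : y ∈ Ioo 0 1 := ⟨hy.1.trans hy'.1, hy'.2⟩
        obtain ⟨m3, e3⟩ := ratioRadius_spec hR h₂ hy01
        have hp := cylCurv_sub_fluxRatio_pos hR h₂ m3
        rw [e3] at hp
        exact ratioDensity_le (ratioRadius_spec hR h₁ hy01).1.1 (hrad y hy01).le
          (by linarith [m3.2, h₂.2, hR.1.2]) hy01.1 hy01.2 hp
    _ < leafTime M H ρ₂ x :=
        strictAntiOn_leafTime hR h₂ ⟨hx.1, (hlt.trans h).le⟩ ⟨m2.1, m2.2.le⟩ hxlt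

/-! ### Every point below the critical radius lies on a leaf -/

/-- The time to reach a fixed radius depends continuously on the starting radius. -/
lemma leafTime_continuousOn_start (hR : IsCritRadius M H R) (hx : 0 < x) :
    ContinuousOn (fun ρ => leafTime M H ρ x) (Ico x R) := by
  rw [continuousOn_iff_continuous_domRestrict]
  -- clamping the radius at `x` does not change the integral, and makes the integrand continuous
  have key : ∀ ρ : Ico x R, leafTime M H ρ x =
      ∫ s in (0)..√((ρ : ℝ) - x), 2 * recipSpeed M H ρ (max x (ρ - s ^ 2)) := by
    intro ρ
    refine intervalIntegral.integral_congr fun s hs => ?_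
    rw [uIcc_of_le (Real.sqrt_nonneg _)] at hs
    have h1 := pow_le_pow_left₀ hs.1 hs.2 2
    rw [Real.sq_sqrt (sub_nonneg.2 ρ.2.1)] at h1
    rw [max_eq_right (by linarith)]
  have hcont : Continuous (Function.uncurry fun (ρ : Ico x R) (s : ℝ) =>
      2 * recipSpeed M H ρ (max x (ρ - s ^ 2))) := by
    have hmem : ∀ p : Ico x R × ℝ, (p.1 : ℝ) ∈ Ioo 0 R ∧
        max x (p.1 - p.2 ^ 2) ∈ Icc 0 (p.1 : ℝ) := fun p =>
      ⟨⟨hx.trans_le p.1.2.1, p.1.2.2⟩, hx.le.trans (le_max_left _ _),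
        max_le p.1.2.1 (by linarith [sq_nonneg p.2])⟩
    have hk := continuous_kTilde M H
    refine continuous_const.mul (Continuous.div ?_ ?_ fun p => ?_)
    · unfold flux; fun_prop
    · unfold redGap flux quartic; fun_prop
    · obtain ⟨h1, h2⟩ := hmem p
      exact (mul_pos (by linarith [h2.2, h1.2, hR.1.2])
        (Real.sqrt_pos.2 (redGap_pos hR h1 h2))).ne'
  refine (intervalIntegral.continuous_parametric_intervalIntegral_of_continuous
    (a₀ := 0) (s := fun ρ : Ico x R => √((ρ : ℝ) - x)) hcont (by fun_prop)).congr fun ρ =>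
    (key ρ).symm

/-- For the critical radius, `ρ = R` is a double root of `flux ^ 2 - quartic`. -/
lemma flux_crit_sq_sub_quartic (hR : IsCritRadius M H R) (x : ℝ) :
    flux M H R x ^ 2 - quartic M x = (R - x) ^ 2 *
      ((R ^ 2 + 2 * R * x + 3 * x ^ 2) / 3 + H ^ 2 * (R ^ 2 + R * x + x ^ 2) ^ 2) := by
  have hs := Real.sqrt_pos.2 (quartic_pos hR.1)
  have hm := hR.2
  rw [cylCurv, div_eq_iff hs.ne'] at hm
  rw [flux_sq_sub_quartic hR.1, redGap, flux, kTilde_eq]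
  generalize √(quartic M R) = s at *
  linear_combination ((2 / 3) * (R - x) * (R ^ 2 + R * x + x ^ 2)) * hm

/-- Near the critical radius the slope of a leaf dominates `k / (R - r)`, which is not
integrable. -/
lemma exists_le_leafSlope (hR : IsCritRadius M H R) (hx : x ∈ Ioo 0 R) :
    ∃ k > 0, ∀ ρ ∈ Ioo 0 R, ∀ y ∈ Ico x ρ, k / (R - y) ≤ leafSlope M H ρ y := by
  set S : ℝ → ℝ := fun y =>
    (R ^ 2 + 2 * R * y + 3 * y ^ 2) / 3 + H ^ 2 * (R ^ 2 + R * y + y ^ 2) ^ 2 with hS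
  have hR0 := hR.1.1
  have hSpos : ∀ y, 0 < y → 0 < S y := fun y hy => by positivity
  have hApos : ∀ y ∈ Icc x R, 0 < flux M H R y := by
    intro y hy
    have h1 : y ∈ Ioo 0 (2 * M) := ⟨hx.1.trans_le hy.1, hy.2.trans_lt hR.1.2⟩
    have h2 := hR.strictMonoOn.monotoneOn ⟨h1.1.le, hy.2⟩ ⟨hR0.le, le_rfl⟩ hy.2
    rw [kTilde_eq M H y] at h2
    have h3 := Real.sqrt_pos.2 (quartic_pos h1)
    unfold flux
    linarith
  set f : ℝ → ℝ := fun y => y * flux M H R y / ((2 * M - y) * √(S y)) with hf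
  have hden : ∀ y ∈ Icc x R, 0 < (2 * M - y) * √(S y) := fun y hy =>
    mul_pos (by linarith [hy.2, hR.1.2]) (Real.sqrt_pos.2 (hSpos y (hx.1.trans_le hy.1)))
  have hfc : ContinuousOn f (Icc x R) :=
    ContinuousOn.div (by unfold flux; fun_prop) (by fun_prop) fun y hy => (hden y hy).ne'
  obtain ⟨z, hz, hmin⟩ := isCompact_Icc.exists_isMinOn (nonempty_Icc.2 hx.2.le) hfc
  refine ⟨f z, div_pos (mul_pos (hx.1.trans_le hz.1) (hApos z hz)) (hden z hz), ?_⟩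
  intro ρ hρ y hy
  have hyR : y < R := hy.2.trans hρ.2
  have hyI : y ∈ Icc x R := ⟨hy.1, hyR.le⟩
  have hy0 : 0 < y := hx.1.trans_le hy.1
  have h2M : 0 < 2 * M - y := by linarith [hR.1.2]
  have hA := flux_pos hR hρ ⟨hy0.le, hy.2.le⟩
  have hE := Real.sqrt_pos.2 (sub_pos.2 (quartic_lt_flux_sq hR hρ ⟨hy0.le, hy.2⟩))
  have hAR := hApos y hyI
  have hlt := (flux_lt_flux hR hρ.1 hρ.2 le_rfl y).le
  have hRy : 0 < R - y := sub_pos.2 hyR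
  have hER : √(flux M H R y ^ 2 - quartic M y) = (R - y) * √(S y) := by
    rw [flux_crit_sq_sub_quartic hR, Real.sqrt_mul (sq_nonneg _), Real.sqrt_sq hRy.le]
  have hSy := Real.sqrt_pos.2 (hSpos y hy0)
  have hq : 0 ≤ quartic M y := (quartic_pos ⟨hy0, by linarith⟩).le
  calc f z / (R - y) ≤ f y / (R - y) := div_le_div_of_nonneg_right (hmin hyI) hRy.le
    _ = y / (2 * M - y) * (flux M H R y / √(flux M H R y ^ 2 - quartic M y)) := by
        rw [hER, hf]; field_simp
    _ ≤ y / (2 * M - y) * (flux M H ρ y / √(flux M H ρ y ^ 2 - quartic M y)) := by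
        refine mul_le_mul_of_nonneg_left ?_ (by positivity)
        rw [div_le_div_iff₀ (by rw [hER]; positivity) hE]
        have hsq := pow_le_pow_left₀ hA.le hlt 2
        have hgap := quartic_lt_flux_sq hR hρ ⟨hy0.le, hy.2⟩
        refine (sq_le_sq₀ (by positivity) (by positivity)).1 ?_
        rw [mul_pow, mul_pow, Real.sq_sqrt (by linarith), Real.sq_sqrt (by linarith)]
        linarith [mul_le_mul_of_nonneg_right hsq hq]
    _ = leafSlope M H ρ y := by rw [leafSlope]; field_simp

/-- The time to reach a fixed radius is unbounded as the starting radius tends to `R`: by comparison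
of slopes it is at least `k log ((R - r) / (R - ρ))`. -/
lemma exists_leafTime_ge (hR : IsCritRadius M H R) (hx : x ∈ Ioo 0 R) (B : ℝ) :
    ∃ ρ ∈ Ioo x R, B ≤ leafTime M H ρ x := by
  obtain ⟨k, hk, hslope⟩ := exists_le_leafSlope hR hx
  have hRx : 0 < R - x := sub_pos.2 hx.2
  set e := Real.exp (-((|B| + 1) / k)) with he
  have he0 : 0 < e := Real.exp_pos _
  have he1 : e < 1 := Real.exp_lt_one_iff.2 (by
    have : 0 < (|B| + 1) / k := by positivity
    linarith)
  -- chosen so that `k * log ((R - x) / (R - ρ)) = |B| + 1`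
  set ρ := R - (R - x) * e with hρdef
  have hρ : ρ ∈ Ioo x R := ⟨by nlinarith, by nlinarith⟩
  have hρ' : ρ ∈ Ioo 0 R := ⟨hx.1.trans hρ.1, hρ.2⟩
  refine ⟨ρ, hρ, ?_⟩
  have hd : ∀ y ∈ Ioo x ρ, HasDerivAt (fun y => leafTime M H ρ y - k * Real.log (R - y))
      (-leafSlope M H ρ y - k * (-1 / (R - y))) y := by
    intro y hy
    have h1 : R - y ≠ 0 := by linarith [hy.2, hρ.2]
    exact (hasDerivAt_leafTime hR hρ' ⟨hx.1.trans hy.1, hy.2⟩).sub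
      ((((hasDerivAt_id y).const_sub R).log h1).const_mul k)
  have hanti : AntitoneOn (fun y => leafTime M H ρ y - k * Real.log (R - y)) (Icc x ρ) := by
    refine antitoneOn_of_deriv_nonpos (convex_Icc _ _) ?_ ?_ ?_
    · refine ContinuousOn.sub ((continuousOn_leafTime hR hρ').mono fun y hy =>
        ⟨hx.1.trans_le hy.1, hy.2⟩) (continuousOn_const.mul (ContinuousOn.log (by fun_prop) ?_))
      intro y hy
      linarith [hy.2, hρ.2]
    · rw [interior_Icc]
      exact fun y hy => (hd y hy).differentiableAt.differentiableWithinAt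
    · rw [interior_Icc]
      intro y hy
      rw [(hd y hy).deriv]
      have := hslope ρ hρ' y ⟨hy.1.le, hy.2⟩
      have h2 : k * (-1 / (R - y)) = -(k / (R - y)) := by ring
      rw [h2]
      linarith
  have := hanti ⟨le_rfl, hρ.1.le⟩ ⟨hρ.1.le, le_rfl⟩ hρ.1.le
  simp only [leafTime_self] at this
  have hlog : k * Real.log (R - ρ) = k * Real.log (R - x) - (|B| + 1) := by
    rw [hρdef, sub_sub_cancel, Real.log_mul hRx.ne' he0.ne', he, Real.log_exp]
    field_simp
    ring
  rw [hlog] at this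
  linarith [le_abs_self B]

lemma exists_leafTime_eq (hR : IsCritRadius M H R) (hx : x ∈ Ioo 0 R) {T : ℝ} (hT : 0 ≤ T) :
    ∃ ρ ∈ Ico x R, leafTime M H ρ x = T := by
  obtain ⟨ρ, hρ, hB⟩ := exists_leafTime_ge hR hx T
  have hc := (leafTime_continuousOn_start hR hx.1).mono (Icc_subset_Ico_right hρ.2)
  obtain ⟨ρ', h', e⟩ := intermediate_value_Icc hρ.1.le hc ⟨(leafTime_self M H x).symm ▸ hT, hB⟩
  exact ⟨ρ', ⟨h'.1, h'.2.trans_lt hρ.2⟩, e⟩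

/-! ### Mean curvature of a spherically symmetric graph -/

/-- The components `∂ᵢ Fᵐ` of the coordinate frame of the graph `r = g(t)`, where `v = g'(t)`. -/
def graphFrame (v : ℝ) : Matrix (Fin 4) (Fin 3) ℝ := !![1, 0, 0; v, 0, 0; 0, 1, 0; 0, 0, 1]

lemma pderiv_sphGraph (g : ℝ → ℝ) (z : Fin 3 → ℝ) (m : Fin 4) (i : Fin 3) :
    pderiv (fun z => sphGraph g z m) i z = graphFrame (deriv g (z 0)) m i := by
  fin_cases m <;> fin_cases i <;> simp [pderiv, sphGraph, graphFrame, Function.update]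

lemma pderiv_pderiv_sphGraph (g : ℝ → ℝ) (y : Fin 3 → ℝ) (m : Fin 4) (i j : Fin 3) :
    pderiv (fun z => pderiv (fun w => sphGraph g w m) j z) i y =
      if m = 1 ∧ i = 0 ∧ j = 0 then deriv (deriv g) (y 0) else 0 := by
  simp only [pderiv_sphGraph]
  fin_cases m <;> fin_cases i <;> fin_cases j <;>
    simp [pderiv, graphFrame, Function.update]

/-- The partial derivatives `∂ₐ g_ss` of the diagonal entries of the Schwarzschild metric at
radius `r` and latitude `θ`. -/
def metricDeriv (M r θ : ℝ) : Matrix (Fin 4) (Fin 4) ℝ :=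
  !![0, -(2 * M) / r ^ 2, 0, 0;
     0, -(2 * M / r ^ 2) / (1 - 2 * M / r) ^ 2, 0, 0;
     0, 2 * r, 0, 0;
     0, 2 * r * Real.sin θ ^ 2, r ^ 2 * (2 * Real.sin θ * Real.cos θ), 0]

lemma pderiv_schwarzschild (p : Fin 4 → ℝ) (hr : p 1 ≠ 0) (hh : 1 - 2 * M / p 1 ≠ 0)
    (s b a : Fin 4) : pderiv (fun y => schwarzschild M y s b) a p =
      if s = b then metricDeriv M (p 1) (p 2) s a else 0 := by
  by_cases hsb : s = b
  swap
  · simp [pderiv, schwarzschild, hsb]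
  subst hsb
  have h1 : HasDerivAt (fun r : ℝ => 1 - 2 * M / r) (2 * M / p 1 ^ 2) (p 1) := by
    refine (((hasDerivAt_inv hr).const_mul (2 * M)).const_sub 1).congr_deriv ?_
    field_simp
  have h2 : HasDerivAt (fun r : ℝ => (1 - 2 * M / r)⁻¹)
      (-(2 * M / p 1 ^ 2) / (1 - 2 * M / p 1) ^ 2) (p 1) := h1.fun_inv hh
  have h4 : ∀ k : ℝ, deriv (fun r : ℝ => r ^ 2 * k) (p 1) = 2 * p 1 * k := by
    intro k
    simp
  have h5 : ∀ k : ℝ, deriv (fun θ : ℝ => k * Real.sin θ ^ 2) (p 2) =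
      k * (2 * Real.sin (p 2) * Real.cos (p 2)) := by
    intro k
    simp
  simp only [pderiv, schwarzschild, Matrix.diagonal_apply_eq, if_true]
  fin_cases s <;> fin_cases a <;>
    simp [metricDeriv, Function.update, h2.deriv, h4, h5]

lemma inv_diagonal_of_ne_zero {n : ℕ} (d : Fin n → ℝ) (hd : ∀ i, d i ≠ 0) :
    (Matrix.diagonal d)⁻¹ = Matrix.diagonal fun i => (d i)⁻¹ := by
  refine Matrix.inv_eq_right_inv ?_
  rw [Matrix.diagonal_mul_diagonal, ← Matrix.diagonal_one]
  congr 1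
  ext i
  exact mul_inv_cancel₀ (hd i)

/-- The diagonal entries of the Schwarzschild metric. -/
def metricDiag (M r θ : ℝ) : Fin 4 → ℝ :=
  ![-(1 - 2 * M / r), (1 - 2 * M / r)⁻¹, r ^ 2, r ^ 2 * Real.sin θ ^ 2]

lemma christoffel_schwarzschild (p : Fin 4 → ℝ) (hr : p 1 ≠ 0) (hh : 1 - 2 * M / p 1 ≠ 0)
    (hθ : Real.sin (p 2) ≠ 0) (m a b : Fin 4) :
    christoffel (schwarzschild M) p m a b = (1 / 2) * ((metricDiag M (p 1) (p 2) m)⁻¹ *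
      ((if m = b then metricDeriv M (p 1) (p 2) m a else 0) +
       (if m = a then metricDeriv M (p 1) (p 2) m b else 0) -
       (if a = b then metricDeriv M (p 1) (p 2) a m else 0))) := by
  have hd : ∀ i, metricDiag M (p 1) (p 2) i ≠ 0 := by
    intro i
    fin_cases i <;> simp [metricDiag, hr, hh, hθ, neg_eq_zero, -neg_sub]
  have hinv : (schwarzschild M p)⁻¹ =
      Matrix.diagonal fun i => (metricDiag M (p 1) (p 2) i)⁻¹ := inv_diagonal_of_ne_zero _ hd
  rw [christoffel, hinv, Finset.sum_eq_single m]
  · simp only [Matrix.diagonal_apply_eq, pderiv_schwarzschild p hr hh]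
  · intro s _ hs
    rw [Matrix.diagonal_apply_ne _ hs.symm, zero_mul]
  · simp

lemma firstForm_sphGraph (g : ℝ → ℝ) (y : Fin 3 → ℝ) :
    firstForm (schwarzschild M) (sphGraph g) y = Matrix.diagonal
      ![-(1 - 2 * M / g (y 0)) + (1 - 2 * M / g (y 0))⁻¹ * deriv g (y 0) ^ 2, g (y 0) ^ 2,
        g (y 0) ^ 2 * Real.sin (y 1) ^ 2] := by
  ext i j
  simp only [firstForm, pderiv_sphGraph, Matrix.of_apply]
  fin_cases i <;> fin_cases j <;>
    simp [Fin.sum_univ_four, schwarzschild, sphGraph, graphFrame, Matrix.diagonal_apply]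
  ring

/-- The diagonal of the second fundamental form of the graph `r = g(t)`; `v = g'`, `a = g''` and
`h = 1 - 2M / r`. -/
lemma secondForm_sphGraph_diag (g : ℝ → ℝ) (y : Fin 3 → ℝ) (hr : g (y 0) ≠ 0)
    (hh : 1 - 2 * M / g (y 0) ≠ 0) (hθ : Real.sin (y 1) ≠ 0) (n₀ n₁ : ℝ) :
    let r := g (y 0)
    let v := deriv g (y 0)
    let a := deriv (deriv g) (y 0)
    let h := 1 - 2 * M / r
    let K := secondForm (schwarzschild M) (sphGraph g) ![n₀, n₁, 0, 0] y
    K 0 0 = n₀ * v * (2 * M / r ^ 2) -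
      n₁ / h * (a + h * (M / r ^ 2) - M / r ^ 2 / h * v ^ 2) ∧
    K 1 1 = r * n₁ ∧ K 2 2 = r * Real.sin (y 1) ^ 2 * n₁ := by
  intro r v a h K
  have hp1 : sphGraph g y 1 = r := rfl
  have hp2 : sphGraph g y 2 = y 1 := rfl
  have hr' : r ≠ 0 := hr
  have hh' : h ≠ 0 := hh
  have hΓ := christoffel_schwarzschild (M := M) (sphGraph g y) hr hh hθ
  have hg : ∀ i j, schwarzschild M (sphGraph g y) i j =
      if i = j then metricDiag M r (y 1) i else 0 := fun i j => Matrix.diagonal_apply _ _ _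
  have hm0 : metricDiag M r (y 1) 0 = -h := rfl
  have hm1 : metricDiag M r (y 1) 1 = h⁻¹ := rfl
  have hm2 : metricDiag M r (y 1) 2 = r ^ 2 := rfl
  have hm3 : metricDiag M r (y 1) 3 = r ^ 2 * Real.sin (y 1) ^ 2 := rfl
  have hD : metricDeriv M r (y 1) = !![0, -(2 * M) / r ^ 2, 0, 0;
     0, -(2 * M / r ^ 2) / h ^ 2, 0, 0;
     0, 2 * r, 0, 0;
     0, 2 * r * Real.sin (y 1) ^ 2, r ^ 2 * (2 * Real.sin (y 1) * Real.cos (y 1)), 0] := rfl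
  have hv : deriv g (y 0) = v := rfl
  have ha : deriv (deriv g) (y 0) = a := rfl
  simp only [K, secondForm, covDeriv, Matrix.of_apply, pderiv_pderiv_sphGraph]
  simp only [pderiv_sphGraph, hΓ, hp1, hp2, hg, hv, ha]
  clear_value h v a r
  refine ⟨?_, ?_, ?_⟩
  · simp [Fin.sum_univ_four, graphFrame, hm0, hm1, hm2, hm3, hD]
    field_simp
    ring
  · simp [Fin.sum_univ_four, graphFrame, hm0, hm1, hm2, hm3, hD]
    field_simp
  · simp [Fin.sum_univ_four, graphFrame, hm0, hm1, hm2, hm3, hD]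
    field_simp

/-- The derivative of the function `speedSq`, with `A = H r³ + c`. -/
lemma hasDerivAt_speedSq {c : ℝ} (hx : x ≠ 0) (hA : H * x ^ 3 + c ≠ 0) :
    HasDerivAt (speedSq M H c)
      (2 * ((2 * M - x) / x) * (-(2 * M) / x ^ 2) * (1 - quartic M x / (H * x ^ 3 + c) ^ 2) +
        ((2 * M - x) / x) ^ 2 * (-(x ^ 2 * (6 * M - 4 * x)) / (H * x ^ 3 + c) ^ 2 +
          quartic M x * (6 * H * x ^ 2) / (H * x ^ 3 + c) ^ 3)) x := by
  have h1 : HasDerivAt (fun x : ℝ => H * x ^ 3 + c) (H * (3 * x ^ 2)) x := by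
    refine ((((hasDerivAt_id x).fun_pow 3).const_mul H).add_const c).congr_deriv ?_
    simp
  have h2 : HasDerivAt (fun x : ℝ => (2 * M - x) / x) (-(2 * M) / x ^ 2) x := by
    refine (((hasDerivAt_id x).const_sub (2 * M)).fun_div (hasDerivAt_id x) hx).congr_deriv ?_
    simp only [id]
    ring
  refine ((h2.fun_pow 2).fun_mul (((hasDerivAt_quartic M x).fun_div (h1.fun_pow 2)
    (pow_ne_zero 2 hA)).const_sub 1)).congr_deriv ?_
  simp only [Nat.cast_ofNat, Nat.add_one_sub_one, pow_one]
  field_simp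
  ring

/-- A spherically symmetric graph with `(r')² = Q(r)` and `r'' = Q'(r) / 2`, where `Q` is
`speedSq M H c`, is spacelike with constant mean curvature `H`: its future unit normal satisfies
`r² Nʳ = H r³ + c`. -/
lemma cmc_sphGraph {c : ℝ} (g : ℝ → ℝ) (y : Fin 3 → ℝ) (hg : g (y 0) ∈ Ioo 0 (2 * M))
    (hA : 0 < H * g (y 0) ^ 3 + c) (hv : deriv g (y 0) ^ 2 = speedSq M H c (g (y 0)))
    (ha : HasDerivAt (speedSq M H c) (2 * deriv (deriv g) (y 0)) (g (y 0)))
    (hθ : y 1 ∈ Ioo 0 Real.pi) :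
    (firstForm (schwarzschild M) (sphGraph g) y).PosDef ∧
      ∃ N : Fin 4 → ℝ,
        (∑ a, ∑ b, schwarzschild M (sphGraph g y) a b * N a * N b) = -1 ∧
        (∀ i, (∑ a, ∑ b, schwarzschild M (sphGraph g y) a b * N a *
          pderiv (fun z => sphGraph g z b) i y) = 0) ∧
        0 < N 1 ∧
        meanCurvature (schwarzschild M) (sphGraph g) N y = H := by
  have hsin := Real.sin_pos_of_mem_Ioo hθ
  have hF := firstForm_sphGraph (M := M) g y
  have hK := secondForm_sphGraph_diag (M := M) g y
  have hmet : ∀ i j, schwarzschild M (sphGraph g y) i j =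
      if i = j then metricDiag M (g (y 0)) (y 1) i else 0 :=
    fun i j => Matrix.diagonal_apply _ _ _
  have hm0 : metricDiag M (g (y 0)) (y 1) 0 = -(1 - 2 * M / g (y 0)) := rfl
  have hm1 : metricDiag M (g (y 0)) (y 1) 1 = (1 - 2 * M / g (y 0))⁻¹ := rfl
  simp only [pderiv_sphGraph, hmet]
  have ha' := ha.unique (hasDerivAt_speedSq hg.1.ne' hA.ne')
  clear ha
  set r := g (y 0)
  set v := deriv g (y 0)
  set a := deriv (deriv g) (y 0)
  set A := H * r ^ 3 + c with hAdef
  have hr0 : 0 < r := hg.1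
  have h2M : 0 < 2 * M - r := by linarith [hg.2]
  have hh : 1 - 2 * M / r = -((2 * M - r) / r) := by field_simp; ring
  have hh0 : 1 - 2 * M / r ≠ 0 := by rw [hh]; exact (neg_neg_of_pos (by positivity)).ne
  rw [speedSq, ← hAdef, quartic] at hv
  rw [quartic] at ha'
  replace hK := hK hr0.ne' hh0 hsin.ne'
  simp only at hK
  have hI : -(1 - 2 * M / r) + (1 - 2 * M / r)⁻¹ * v ^ 2 = (r * (2 * M - r) / A) ^ 2 := by
    rw [hv, hh]
    field_simp
    ring
  rw [hI] at hF
  rw [hh] at hK hm0 hm1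
  set h' := (2 * M - r) / r with hh'
  have hpos : 0 < h' := by positivity
  refine ⟨?_, ![A / r ^ 2 * v / h' ^ 2, A / r ^ 2, 0, 0], ?_, ?_, ?_, ?_⟩
  · rw [hF]
    refine Matrix.PosDef.diagonal fun i => ?_
    fin_cases i <;> simp <;> positivity
  · simp [Fin.sum_univ_four, hm0, hm1]
    have e : h' * (A / r ^ 2 * v / h' ^ 2) * (A / r ^ 2 * v / h' ^ 2) =
        A ^ 2 / (r ^ 4 * h' ^ 3) * v ^ 2 := by field_simp
    rw [e, hv, hh']
    field_simp
    ring
  · intro i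
    fin_cases i <;> simp [Fin.sum_univ_four, hm0, hm1, graphFrame]
    field_simp
    ring
  · simp; positivity
  · obtain ⟨k0, k1, k2⟩ := hK (A / r ^ 2 * v / h' ^ 2) (A / r ^ 2)
    rw [meanCurvature, hF, inv_diagonal_of_ne_zero]
    swap
    · intro i
      have hs := hsin.ne'
      fin_cases i <;> simp
      · exact ⟨⟨hr0.ne', h2M.ne'⟩, hA.ne'⟩
      · exact hr0.ne'
      · exact ⟨hr0.ne', hs⟩
    rw [Matrix.trace, Fin.sum_univ_three]
    simp only [Matrix.diag_apply, Matrix.diagonal_mul, k0, k1, k2]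
    simp
    have e : A / r ^ 2 * v / h' ^ 2 * v = A / (r ^ 2 * h' ^ 2) * v ^ 2 := by field_simp
    have ha2 : a = (2 * a) / 2 := by ring
    rw [e, hv, ha2, ha', hh']
    field_simp
    rw [hAdef]
    ring

/-! ### The Kruskal plane in the coordinates `(t, UV)` -/

/-- The product `UV` as a function of the radius. -/
def kruskalProd (M r : ℝ) : ℝ := (r - 2 * M) * Real.exp (r / (2 * M))

lemma continuous_kruskalProd (M : ℝ) : Continuous (kruskalProd M) := by
  unfold kruskalProd; fun_prop

lemma kruskalProd_neg (hx : x < 2 * M) : kruskalProd M x < 0 :=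
  mul_neg_of_neg_of_pos (by linarith) (Real.exp_pos _)

/-- The derivative is `r / (2M) * exp (r / (2M))`. -/
lemma kruskalProd_strictMonoOn (hM : 0 < M) : StrictMonoOn (kruskalProd M) (Ici 0) := by
  refine strictMonoOn_of_deriv_pos (convex_Ici _) (continuous_kruskalProd M).continuousOn
    fun r hr => ?_
  rw [interior_Ici] at hr
  have hr : 0 < r := hr
  have hd : HasDerivAt (kruskalProd M) (Real.exp (r / (2 * M)) * (r / (2 * M))) r := by
    refine (((hasDerivAt_id r).sub_const (2 * M)).mul
      ((hasDerivAt_id r).div_const (2 * M)).exp).congr_deriv ?_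
    simp only [id]
    field_simp
    ring
  rw [hd.deriv]
  positivity

/-- The quadrant `U > 0`, `V < 0` of the Kruskal plane as the image of the half
plane `z < 0` under `(t, z) ↦ (U, V)`, where `z = UV`. -/
def kruskalChart (M : ℝ) (hM : 0 < M) : OpenPartialHomeomorph (ℝ × ℝ) (ℝ × ℝ) where
  toFun p := (√(-p.2) * Real.exp (-p.1 / (4 * M)), -(√(-p.2) * Real.exp (p.1 / (4 * M))))
  invFun q := (2 * M * (Real.log (-q.2) - Real.log q.1), q.1 * q.2)
  source := univ ×ˢ Iio 0
  target := Ioi 0 ×ˢ Iio 0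
  map_source' p hp := by
    have : 0 < √(-p.2) := Real.sqrt_pos.2 (neg_pos.2 hp.2)
    exact ⟨by simp only [mem_Ioi]; positivity, by simp only [mem_Iio, neg_lt_zero]; positivity⟩
  map_target' q hq := ⟨mem_univ _, mul_neg_of_pos_of_neg hq.1 hq.2⟩
  left_inv' p hp := by
    have hz : 0 < -p.2 := neg_pos.2 hp.2
    have hs := Real.sqrt_pos.2 hz
    ext
    · simp only [neg_neg]
      rw [Real.log_mul hs.ne' (Real.exp_pos _).ne', Real.log_mul hs.ne' (Real.exp_pos _).ne',
        Real.log_exp, Real.log_exp]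
      field_simp
      ring
    · have : √(-p.2) * Real.exp (-p.1 / (4 * M)) * -(√(-p.2) * Real.exp (p.1 / (4 * M))) =
          -(√(-p.2) ^ 2 * (Real.exp (-p.1 / (4 * M)) * Real.exp (p.1 / (4 * M)))) := by ring
      simp only [this]
      rw [Real.sq_sqrt hz.le, ← Real.exp_add, neg_div, neg_add_cancel, Real.exp_zero]
      ring
  right_inv' q hq := by
    obtain ⟨U, V⟩ := q
    have hU : 0 < U := hq.1
    have hV : 0 < -V := neg_pos.2 hq.2
    obtain ⟨u, rfl⟩ : ∃ u, Real.exp u = U := ⟨_, Real.exp_log hU⟩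
    obtain ⟨v, hv⟩ : ∃ v, Real.exp v = -V := ⟨_, Real.exp_log hV⟩
    obtain rfl : V = -Real.exp v := by rw [hv, neg_neg]
    have h1 : √(Real.exp (u + v)) = Real.exp ((u + v) / 2) := (Real.exp_half _).symm
    simp only [neg_neg, mul_neg, Real.log_exp, ← Real.exp_add, h1]
    ext
    · simp only
      congr 1
      field_simp
      ring
    · simp only
      congr 2
      field_simp
      ring
  open_source := isOpen_univ.prod isOpen_Iio
  open_target := isOpen_Ioi.prod isOpen_Iio
  continuousOn_toFun := by fun_prop
  continuousOn_invFun := by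
    have h1 : ContinuousOn (fun q : ℝ × ℝ => Real.log (-q.2)) (Ioi 0 ×ˢ Iio 0) :=
      ContinuousOn.log (by fun_prop) fun q hq => (neg_pos.2 hq.2).ne'
    have h2 : ContinuousOn (fun q : ℝ × ℝ => Real.log q.1) (Ioi 0 ×ˢ Iio 0) :=
      ContinuousOn.log (by fun_prop) fun q hq => (hq.1 : 0 < q.1).ne'
    exact (continuousOn_const.mul (h1.sub h2)).prodMk (by fun_prop)

lemma toKruskal_eq (hM : 0 < M) (t : ℝ) (hx : x < 2 * M) :
    toKruskal M t x = kruskalChart M hM (t, kruskalProd M x) := by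
  have h1 : -kruskalProd M x = Real.exp (Real.log (2 * M - x) + x / (2 * M)) := by
    rw [Real.exp_add, Real.exp_log (by linarith), kruskalProd]; ring
  change _ = (√(-kruskalProd M x) * Real.exp (-t / (4 * M)),
    -(√(-kruskalProd M x) * Real.exp (t / (4 * M))))
  rw [h1, ← Real.exp_half, ← Real.exp_add, ← Real.exp_add, toKruskal, abs_sub_comm,
    abs_of_pos (by linarith : 0 < 2 * M - x)]
  congr 3 <;> · field_simp; ring

lemma toKruskal_inj (hM : 0 < M) {t t' x' : ℝ} (hx : x ∈ Ioo 0 (2 * M)) (hx' : x' ∈ Ioo 0 (2 * M))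
    (h : toKruskal M t x = toKruskal M t' x') : t = t' ∧ x = x' := by
  rw [toKruskal_eq hM t hx.2, toKruskal_eq hM t' hx'.2] at h
  have hs : (t, kruskalProd M x) ∈ (kruskalChart M hM).source :=
    ⟨mem_univ _, kruskalProd_neg hx.2⟩
  have hs' : (t', kruskalProd M x') ∈ (kruskalChart M hM).source :=
    ⟨mem_univ _, kruskalProd_neg hx'.2⟩
  have := (kruskalChart M hM).injOn hs hs' h
  rw [Prod.mk.injEq] at this
  exact ⟨this.1, (kruskalProd_strictMonoOn hM).injOn hx.1.le hx'.1.le this.2⟩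

lemma toKruskal_neg (M t r : ℝ) :
    (-(toKruskal M t r).2, -(toKruskal M t r).1) = toKruskal M (-t) r := by
  simp only [toKruskal, neg_neg]
  congr 2
  · ring_nf
  · ring_nf

lemma mem_regionIIprime (hM : 0 < M) (hR : R < 2 * M) (p : ℝ × ℝ) :
    p ∈ regionIIprime M R ↔ ∃ t, ∃ r ∈ Ioc 0 R, p = toKruskal M t r := by
  constructor
  · rintro ⟨h1, h2, r, hr, h⟩
    have hp : p ∈ (kruskalChart M hM).target := ⟨h1, h2⟩
    refine ⟨((kruskalChart M hM).symm p).1, r, hr, ?_⟩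
    rw [toKruskal_eq hM _ (hr.2.trans_lt hR), ← (kruskalChart M hM).right_inv hp]
    congr 1
    ext
    · rw [(kruskalChart M hM).right_inv hp]
    · exact h
  · rintro ⟨t, r, hr, rfl⟩
    have hr2 := hr.2.trans_lt hR
    rw [toKruskal_eq hM t hr2]
    have hs : (t, kruskalProd M r) ∈ (kruskalChart M hM).source :=
      ⟨mem_univ _, kruskalProd_neg hr2⟩
    obtain ⟨h1, h2⟩ := (kruskalChart M hM).map_source hs
    exact ⟨h1, h2, r, hr, congrArg Prod.snd ((kruskalChart M hM).left_inv hs)⟩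

/-! ### The leaves as graphs -/

/-- The domain of the graph function of the leaf that meets `t = 0` at radius `ρ`; it is the whole
time axis for the cylinders `ρ ≥ R`. -/
def graphDomain (M H R ρ : ℝ) : Set ℝ := if ρ < R then leafDomain M H ρ else univ

/-- The graph function of the leaf that meets `t = 0` at radius `ρ`. The leaves are continued
beyond the critical radius by the cylinders `r = ρ`, `ρ > R`, which provides charts around the
boundary leaf `r = R`. -/
def graphRadius (M H R ρ t : ℝ) : ℝ := if ρ < R then leafRadius M H ρ t else ρ

lemma graph_iff (hR : IsCritRadius M H R) (hρ : ρ ∈ Ioo 0 R) {t : ℝ} :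
    t ∈ graphDomain M H R ρ ∧ graphRadius M H R ρ t = x ↔
      x ∈ Ioc 0 ρ ∧ |t| = leafTime M H ρ x := by
  rw [graphDomain, graphRadius, if_pos hρ.2, if_pos hρ.2, mem_leafDomain_and_iff hR hρ]

lemma graphRadius_of_ge (h : R ≤ ρ) (t : ℝ) : graphRadius M H R ρ t = ρ := if_neg h.not_gt

lemma mem_graphDomain_of_ge (h : R ≤ ρ) (t : ℝ) : t ∈ graphDomain M H R ρ := by
  rw [graphDomain, if_neg h.not_gt]; trivial

lemma isOpen_graphDomain (hR : IsCritRadius M H R) (hρ : 0 < ρ) :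
    IsOpen (graphDomain M H R ρ) := by
  unfold graphDomain
  split_ifs with h
  · exact (leafParam_smooth hR ⟨hρ, h⟩).1
  · exact isOpen_univ

lemma isConnected_graphDomain (hR : IsCritRadius M H R) (hρ : 0 < ρ) :
    IsConnected (graphDomain M H R ρ) := by
  unfold graphDomain
  split_ifs with h
  · exact isConnected_leafDomain hR ⟨hρ, h⟩
  · exact isConnected_univ

lemma contDiffOn_graphRadius (hR : IsCritRadius M H R) (hρ : 0 < ρ) :
    ContDiffOn ℝ (⊤ : ℕ∞) (graphRadius M H R ρ) (graphDomain M H R ρ) := by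
  by_cases h : ρ < R
  · have e : graphRadius M H R ρ = leafRadius M H ρ := funext fun t => if_pos h
    rw [e, graphDomain, if_pos h]
    exact contDiffOn_leafRadius hR ⟨hρ, h⟩
  · have e : graphRadius M H R ρ = fun _ => ρ := funext fun t => if_neg h
    rw [e]
    exact contDiffOn_const

lemma graphRadius_mem (hR : IsCritRadius M H R) (hρ : 0 < ρ) {t : ℝ}
    (ht : t ∈ graphDomain M H R ρ) : graphRadius M H R ρ t ∈ Ioc 0 ρ := by
  by_cases h : ρ < R
  · exact ((graph_iff hR ⟨hρ, h⟩).1 ⟨ht, rfl⟩).1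
  · rw [graphRadius_of_ge (not_lt.1 h)]
    exact ⟨hρ, le_rfl⟩

/-- The leaves are ordered by their starting radius, and outer leaves exist at least as long. -/
lemma graphRadius_lt (hR : IsCritRadius M H R) {ρ₁ ρ₂ t : ℝ} (h₁ : 0 < ρ₁) (h : ρ₁ < ρ₂)
    (ht : t ∈ graphDomain M H R ρ₁) :
    t ∈ graphDomain M H R ρ₂ ∧ graphRadius M H R ρ₁ t < graphRadius M H R ρ₂ t := by
  rcases lt_or_ge ρ₂ R with h2 | h2
  · have hρ₂ : ρ₂ ∈ Ioo 0 R := ⟨h₁.trans h, h2⟩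
    obtain ⟨hx, e⟩ := (graph_iff hR ⟨h₁, h.trans h2⟩).1 ⟨ht, rfl⟩
    set r := graphRadius M H R ρ₁ t
    have hlt := leafTime_lt_leafTime hR hρ₂ h hx
    have hr2 : r ≤ ρ₂ := hx.2.trans h.le
    have hc : ContinuousOn (leafTime M H ρ₂) (Icc r ρ₂) :=
      (continuousOn_leafTime hR hρ₂).mono fun y hy => ⟨hx.1.trans_le hy.1, hy.2⟩
    have hmem : |t| ∈ Icc (leafTime M H ρ₂ ρ₂) (leafTime M H ρ₂ r) :=
      ⟨by rw [leafTime_self]; exact abs_nonneg t, by rw [e]; exact hlt.le⟩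
    obtain ⟨r', hr', e'⟩ := intermediate_value_Icc' hr2 hc hmem
    obtain ⟨h3, h4⟩ := (graph_iff hR hρ₂).2 ⟨⟨hx.1.trans_le hr'.1, hr'.2⟩, e'.symm⟩
    refine ⟨h3, h4.symm ▸ hr'.1.lt_of_ne ?_⟩
    intro hne
    rw [← hne] at e'
    exact hlt.ne (e.symm.trans e'.symm)
  · refine ⟨mem_graphDomain_of_ge h2 t, ?_⟩
    rw [graphRadius_of_ge h2]
    exact (graphRadius_mem hR h₁ ht).2.trans_lt h

lemma graph_unique (hR : IsCritRadius M H R) {ρ₁ ρ₂ t : ℝ} (h₁ : 0 < ρ₁) (h₂ : 0 < ρ₂)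
    (ht₁ : t ∈ graphDomain M H R ρ₁) (ht₂ : t ∈ graphDomain M H R ρ₂)
    (h : graphRadius M H R ρ₁ t = graphRadius M H R ρ₂ t) : ρ₁ = ρ₂ := by
  rcases lt_trichotomy ρ₁ ρ₂ with hlt | heq | hgt
  · exact absurd h (graphRadius_lt hR h₁ hlt ht₁).2.ne
  · exact heq
  · exact absurd h (graphRadius_lt hR h₂ hgt ht₂).2.ne'

/-- Every point `(t, r)` lies on a leaf, or on one of the cylinders that continue the family. -/
lemma exists_graph (hR : IsCritRadius M H R) (t : ℝ) (hx : 0 < x) :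
    ∃ ρ, x ≤ ρ ∧ (x ≤ R → ρ ≤ R) ∧ (R ≤ x → ρ = x) ∧ t ∈ graphDomain M H R ρ ∧
      graphRadius M H R ρ t = x := by
  rcases lt_or_ge x R with h | h
  · obtain ⟨ρ, hρ, e⟩ := exists_leafTime_eq hR ⟨hx, h⟩ (abs_nonneg t)
    exact ⟨ρ, hρ.1, fun _ => hρ.2.le, fun h' => absurd h h'.not_gt,
      (graph_iff hR ⟨hx.trans_le hρ.1, hρ.2⟩).2 ⟨⟨hx, hρ.1⟩, e.symm⟩⟩
  · exact ⟨x, le_rfl, id, fun _ => rfl, mem_graphDomain_of_ge h t, graphRadius_of_ge h t⟩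

/-- The leaves of the statement, given by the integral `height`, are the graphs of
`graphRadius`. -/
lemma tssLeaf_kTilde (hR : IsCritRadius M H R) (hρ : ρ ∈ Ioc 0 R) :
    tssLeaf M H R (kTilde M H ρ) =
      (fun t => toKruskal M t (graphRadius M H R ρ t)) '' graphDomain M H R ρ := by
  have hinj := hR.strictMonoOn.injOn
  have hIcc : ∀ {r}, r ∈ Ioc 0 R → r ∈ Icc 0 R := fun h => Ioc_subset_Icc_self h
  rcases hρ.2.eq_or_lt with rfl | hlt
  · ext p
    rw [tssLeaf, if_pos rfl]
    simp only [graphRadius_of_ge le_rfl, mem_ofPred_eq, mem_image]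
    exact ⟨fun ⟨t, h⟩ => ⟨t, mem_graphDomain_of_ge le_rfl t, h.symm⟩, fun ⟨t, _, h⟩ => ⟨t, h.symm⟩⟩
  have hρ' : ρ ∈ Ioo 0 R := ⟨hρ.1, hlt⟩
  have hne : kTilde M H ρ ≠ kTilde M H R := fun h =>
    hlt.ne (hinj (hIcc hρ) ⟨hR.1.1.le, le_rfl⟩ h)
  ext p
  rw [tssLeaf, if_neg hne]
  constructor
  · rintro ⟨ρ', hρ'', e, r, hr, h⟩
    obtain rfl : ρ' = ρ := hinj (hIcc (Ioo_subset_Ioc_self hρ'')) (hIcc hρ) e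
    rw [height_eq hR hρ' hr, neg_neg] at h
    have h0 := leafTime_nonneg hR hρ' hr
    rcases h with rfl | rfl
    · obtain ⟨h1, h2⟩ := (graph_iff hR hρ' (t := -leafTime M H ρ' r)).2
        ⟨hr, by rw [abs_neg, abs_of_nonneg h0]⟩
      exact ⟨_, h1, by simp only [h2]⟩
    · obtain ⟨h1, h2⟩ := (graph_iff hR hρ').2 ⟨hr, abs_of_nonneg h0⟩
      exact ⟨_, h1, by simp only [h2]⟩
  · rintro ⟨t, ht, rfl⟩
    obtain ⟨hr, e⟩ := (graph_iff hR hρ').1 ⟨ht, rfl⟩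
    refine ⟨ρ, hρ', rfl, _, hr, ?_⟩
    rw [height_eq hR hρ' hr, neg_neg, ← e]
    rcases abs_choice t with h | h
    · right; rw [h]
    · left; rw [h, neg_neg]

lemma toKruskal_mem_tssLeaf (hM : 0 < M) (hR : IsCritRadius M H R) (hρ : ρ ∈ Ioc 0 R) {t : ℝ}
    (hx : x ∈ Ioo 0 (2 * M)) : toKruskal M t x ∈ tssLeaf M H R (kTilde M H ρ) ↔
      t ∈ graphDomain M H R ρ ∧ graphRadius M H R ρ t = x := by
  rw [tssLeaf_kTilde hR hρ]
  constructor
  · rintro ⟨t', ht', h⟩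
    have hm := graphRadius_mem hR hρ.1 ht'
    obtain ⟨rfl, h2⟩ := toKruskal_inj hM ⟨hm.1, (hm.2.trans hρ.2).trans_lt hR.1.2⟩ hx h
    exact ⟨ht', h2⟩
  · rintro ⟨h1, rfl⟩
    exact ⟨t, h1, rfl⟩

lemma IsCritRadius.exists_kTilde_eq_of_mem_Ioc (hR : IsCritRadius M H R) {c : ℝ}
    (hc : c ∈ Ioc 0 (kTilde M H R)) : ∃ ρ ∈ Ioc 0 R, kTilde M H ρ = c := by
  rcases hc.2.eq_or_lt with rfl | h
  · exact ⟨R, ⟨hR.1.1, le_rfl⟩, rfl⟩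
  · obtain ⟨ρ, hρ, e⟩ := hR.exists_kTilde_eq ⟨hc.1, h⟩
    exact ⟨ρ, Ioo_subset_Ioc_self hρ, e⟩

/-- The differential equation that makes the leaves hypersurfaces of constant mean curvature. For
the cylinder it says that `speedSq` has a double zero at the critical radius. -/
lemma graphRadius_ode (hR : IsCritRadius M H R) (hρ : ρ ∈ Ioc 0 R) {t : ℝ}
    (ht : t ∈ graphDomain M H R ρ) :
    0 < H * graphRadius M H R ρ t ^ 3 + kTilde M H ρ ∧
    deriv (graphRadius M H R ρ) t ^ 2 = speedSq M H (kTilde M H ρ) (graphRadius M H R ρ t) ∧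
    HasDerivAt (speedSq M H (kTilde M H ρ)) (2 * deriv (deriv (graphRadius M H R ρ)) t)
      (graphRadius M H R ρ t) := by
  have hm := graphRadius_mem hR hρ.1 ht
  rcases hρ.2.eq_or_lt with rfl | h
  · have e : graphRadius M H ρ ρ = fun _ => ρ := funext fun t => graphRadius_of_ge le_rfl t
    have hs := Real.sqrt_pos.2 (quartic_pos hR.1)
    have hA : H * ρ ^ 3 + kTilde M H ρ = √(quartic M ρ) := flux_self M H ρ
    have hq : √(quartic M ρ) ^ 2 = quartic M ρ := Real.sq_sqrt (quartic_pos hR.1).le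
    have hcyl := hR.2
    have h2M : 0 < 2 * M - ρ := by linarith [hR.1.2]
    have h0 := hρ.1
    rw [cylCurv, div_eq_iff hs.ne'] at hcyl
    rw [e]
    simp only [hA, speedSq, hq, div_self (quartic_pos hR.1).ne']
    refine ⟨hs, by simp, ?_⟩
    refine (hasDerivAt_speedSq h0.ne' (by rw [hA]; exact hs.ne')).congr_deriv ?_
    have h3 : (6 * M - 4 * ρ) = 6 * H * √(quartic M ρ) := by linear_combination 2 * hcyl
    have h4 : √(quartic M ρ) ^ 3 = quartic M ρ * √(quartic M ρ) := by rw [pow_succ, hq]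
    have hq0 := quartic_pos hR.1
    rw [hA, hq, h3, h4, div_self hq0.ne']
    simp
    right
    field_simp
    rw [hq]
    ring
  · have e : graphRadius M H R ρ = leafRadius M H ρ := funext fun t => if_pos h
    have hd : t ∈ leafDomain M H ρ := by rwa [graphDomain, if_pos h] at ht
    rw [e] at hm ⊢
    exact ⟨flux_pos hR ⟨hρ.1, h⟩ (Ioc_subset_Icc_self hm), leafRadius_ode hR ⟨hρ.1, h⟩ hd⟩

lemma isTSSCMC_tssLeaf (hM : 0 < M) (hR : IsCritRadius M H R) (hρ : ρ ∈ Ioc 0 R) :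
    IsTSSCMC M H (tssLeaf M H R (kTilde M H ρ)) := by
  have hmem : ∀ t ∈ graphDomain M H R ρ, graphRadius M H R ρ t ∈ Ioo 0 (2 * M) := fun t ht =>
    ⟨(graphRadius_mem hR hρ.1 ht).1,
      ((graphRadius_mem hR hρ.1 ht).2.trans hρ.2).trans_lt hR.1.2⟩
  refine ⟨fun U V h => ?_, graphDomain M H R ρ, graphRadius M H R ρ, isOpen_graphDomain hR hρ.1,
    isConnected_graphDomain hR hρ.1, contDiffOn_graphRadius hR hρ.1, hmem,
    tssLeaf_kTilde hR hρ, fun y hy hθ => ?_⟩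
  · rw [tssLeaf_kTilde hR hρ] at h
    obtain ⟨t, ht, h⟩ := h
    simp only at h
    have h' := toKruskal_neg M t (graphRadius M H R ρ t)
    rw [h] at h'
    simp only at h'
    rw [h', toKruskal_mem_tssLeaf hM hR hρ (hmem t ht)]
    rcases hρ.2.eq_or_lt with rfl | hlt
    · simp only [graphRadius_of_ge le_rfl, mem_graphDomain_of_ge le_rfl, and_self]
    · have hρ' : ρ ∈ Ioo 0 R := ⟨hρ.1, hlt⟩
      rw [graph_iff hR hρ', abs_neg]
      exact (graph_iff hR hρ').1 ⟨ht, rfl⟩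
  · obtain ⟨h1, h2, h3⟩ := graphRadius_ode hR hρ hy
    exact cmc_sphGraph _ y (hmem _ hy) h1 h2 h3 hθ

/-! ### Foliation charts -/

/-- A map `(t, c) ↦ (t, F t c)` that is continuous in each variable separately and strictly
increasing in `c` is a homeomorphism from an open rectangle onto an open set. -/
lemma exists_openPartialHomeomorph_fiber (F : ℝ → ℝ → ℝ) {a₁ b₁ a₂ b₂ : ℝ}
    (hmono : ∀ t ∈ Ioo a₁ b₁, StrictMonoOn (F t) (Ioo a₂ b₂))
    (hc₁ : ∀ t ∈ Ioo a₁ b₁, ContinuousOn (F t) (Ioo a₂ b₂))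
    (hc₂ : ∀ c ∈ Ioo a₂ b₂, ContinuousOn (fun t => F t c) (Ioo a₁ b₁)) :
    ∃ e : OpenPartialHomeomorph (ℝ × ℝ) (ℝ × ℝ), e.source = Ioo a₁ b₁ ×ˢ Ioo a₂ b₂ ∧
      ∀ p, e p = (p.1, F p.1 p.2) := by
  set S : Set (ℝ × ℝ) := Ioo a₁ b₁ ×ˢ Ioo a₂ b₂ with hSdef
  set f : ℝ × ℝ → ℝ × ℝ := fun p => (p.1, F p.1 p.2) with hf
  have hSo : IsOpen S := isOpen_Ioo.prod isOpen_Ioo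
  have hinj : InjOn f S := by
    rintro ⟨t, c⟩ h ⟨t', c'⟩ h' heq
    obtain ⟨rfl, h2⟩ := Prod.mk.inj heq
    exact Prod.ext rfl ((hmono t h.1).injOn h.2 h'.2 h2)
  have ht : ∀ t ∈ Ioo a₁ b₁, ∀ c ∈ Ioo a₂ b₂, ContinuousAt (fun t => F t c) t :=
    fun t ht c hc => (hc₂ c hc).continuousAt (isOpen_Ioo.mem_nhds ht)
  have hcont : ContinuousOn f S := by
    rintro ⟨t₀, c₀⟩ ⟨h1, h2⟩
    refine ContinuousAt.continuousWithinAt (continuousAt_fst.prodMk ?_)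
    have hev : ∀ᶠ p : ℝ × ℝ in 𝓝 (t₀, c₀), p ∈ S := hSo.mem_nhds ⟨h1, h2⟩
    have hB : ∀ᶠ c in 𝓝 c₀, c ∈ Ioo a₂ b₂ := isOpen_Ioo.mem_nhds h2
    have hcc : ContinuousAt (F t₀) c₀ := (hc₁ t₀ h1).continuousAt (isOpen_Ioo.mem_nhds h2)
    refine tendsto_order.2 ⟨fun l hl => ?_, fun u hu => ?_⟩
    · obtain ⟨c, ⟨hc1, hc2⟩, hc3⟩ := (((hcc.eventually (lt_mem_nhds hl)).and hB).filter_mono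
        nhdsWithin_le_nhds |>.and (self_mem_nhdsWithin (s := Iio c₀))).exists
      have e1 := ((ht t₀ h1 c hc2).eventually (lt_mem_nhds hc1)).prod_inl_nhds c₀
      have e2 : ∀ᶠ p : ℝ × ℝ in 𝓝 (t₀, c₀), c < p.2 :=
        continuousAt_snd.eventually (lt_mem_nhds hc3)
      filter_upwards [e1, e2, hev] with p h3 h4 h5
      exact h3.trans (hmono p.1 h5.1 hc2 h5.2 h4)
    · obtain ⟨c, ⟨hc1, hc2⟩, hc3⟩ := (((hcc.eventually (gt_mem_nhds hu)).and hB).filter_mono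
        nhdsWithin_le_nhds |>.and (self_mem_nhdsWithin (s := Ioi c₀))).exists
      have e1 := ((ht t₀ h1 c hc2).eventually (gt_mem_nhds hc1)).prod_inl_nhds c₀
      have e2 : ∀ᶠ p : ℝ × ℝ in 𝓝 (t₀, c₀), p.2 < c :=
        continuousAt_snd.eventually (gt_mem_nhds hc3)
      filter_upwards [e1, e2, hev] with p h3 h4 h5
      exact (hmono p.1 h5.1 h5.2 hc2 h4).trans h3
  have hopen : IsOpenMap (S.domRestrict f) := by
    refine isOpenMap_iff_nhds_le.2 fun q => ?_
    rw [domRestrict_eq, ← Filter.map_map, map_nhds_subtype_coe_eq_nhds q.2 (hSo.mem_nhds q.2),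
      Filter.le_map_iff]
    obtain ⟨⟨t₀, c₀⟩, h1, h2⟩ := q
    intro s hs
    change f '' s ∈ 𝓝 (t₀, F t₀ c₀)
    obtain ⟨u, hu, v, hv, huv⟩ := mem_nhds_prod_iff.1 hs
    obtain ⟨l, r, hlr, hsub⟩ := mem_nhds_iff_exists_Ioo_subset.1
      (inter_mem hv (isOpen_Ioo.mem_nhds h2))
    obtain ⟨c, hc1, hc2⟩ := exists_between hlr.1
    obtain ⟨d, hd1, hd2⟩ := exists_between hlr.2
    have hIcc : Icc c d ⊆ v ∩ Ioo a₂ b₂ := fun z hz =>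
      hsub ⟨hc1.trans_le hz.1, hz.2.trans_lt hd2⟩
    have hc := hIcc ⟨le_rfl, (hc2.trans hd1).le⟩
    have hd := hIcc ⟨(hc2.trans hd1).le, le_rfl⟩
    have hcF := hmono t₀ h1 hc.2 h2 hc2
    have hdF := hmono t₀ h1 h2 hd.2 hd1
    have e1 : ∀ᶠ p : ℝ × ℝ in 𝓝 (t₀, F t₀ c₀), F p.1 c < p.2 :=
      Tendsto.eventually_lt ((ht t₀ h1 c hc.2).tendsto.comp continuousAt_fst)
        continuousAt_snd hcF
    have e2 : ∀ᶠ p : ℝ × ℝ in 𝓝 (t₀, F t₀ c₀), p.2 < F p.1 d :=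
      Tendsto.eventually_lt continuousAt_snd
        ((ht t₀ h1 d hd.2).tendsto.comp continuousAt_fst) hdF
    have e3 : ∀ᶠ p : ℝ × ℝ in 𝓝 (t₀, F t₀ c₀), p.1 ∈ u ∩ Ioo a₁ b₁ :=
      continuousAt_fst.eventually (inter_mem hu (isOpen_Ioo.mem_nhds h1))
    filter_upwards [e1, e2, e3] with p h3 h4 h5
    obtain ⟨z, hz, hz'⟩ := intermediate_value_Icc (hc2.trans hd1).le
      ((hc₁ p.1 h5.2).mono fun z hz => (hIcc hz).2) ⟨h3.le, h4.le⟩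
    exact ⟨(p.1, z), huv ⟨h5.1, (hIcc hz).1⟩, Prod.ext rfl hz'⟩
  exact ⟨OpenPartialHomeomorph.ofContinuousOpenRestrict (hinj.toPartialEquiv f S) hcont hopen hSo,
    rfl, fun _ => rfl⟩

/-- At a fixed time the radius depends continuously on the leaf, because it does so monotonically
and takes every value in `(0, 2M)`. -/
lemma continuousAt_graphRadius_leaf (hR : IsCritRadius M H R) {t : ℝ}
    (hρ : ρ ∈ Ioo 0 (2 * M)) (ht : t ∈ graphDomain M H R ρ) :
    ContinuousAt (fun ρ => graphRadius M H R ρ t) ρ := by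
  set s : Set ℝ := {ρ | ρ ∈ Ioo 0 (2 * M) ∧ t ∈ graphDomain M H R ρ} with hs
  have hsurj : ∀ z ∈ Ioo 0 (2 * M), ∃ σ ∈ s, graphRadius M H R σ t = z := by
    intro z hz
    obtain ⟨σ, h1, h2, h3, h4, h5⟩ := exists_graph hR t hz.1
    refine ⟨σ, ⟨⟨hz.1.trans_le h1, ?_⟩, h4⟩, h5⟩
    rcases le_total z R with h | h
    · exact (h2 h).trans_lt hR.1.2
    · rw [h3 h]; exact hz.2
  have hmono : StrictMonoOn (fun ρ => graphRadius M H R ρ t) s := fun a ha b hb hab =>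
    (graphRadius_lt hR ha.1.1 hab ha.2).2
  have hr := graphRadius_mem hR hρ.1 ht
  have hr' : graphRadius M H R ρ t ∈ Ioo 0 (2 * M) := ⟨hr.1, hr.2.trans_lt hρ.2⟩
  refine continuousAt_of_monotoneOn_of_image_mem_nhds hmono.monotoneOn ?_ ?_
  · obtain ⟨z, hz0, hz⟩ := exists_between hr.1
    obtain ⟨σ, hσ, e⟩ := hsurj z ⟨hz0, hz.trans hr'.2⟩
    have hlt : σ < ρ := (hmono.lt_iff_lt hσ ⟨hρ, ht⟩).1 (by simpa only [e] using hz)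
    filter_upwards [Ioo_mem_nhds hlt hρ.2] with τ hτ
    exact ⟨⟨hσ.1.1.trans hτ.1, hτ.2⟩, (graphRadius_lt hR hσ.1.1 hτ.1 hσ.2).1⟩
  · exact mem_of_superset (isOpen_Ioo.mem_nhds hr') fun z hz => hsurj z hz

/-- Near every point the pair `(t, ρ)` is a foliation chart. -/
lemma exists_foliation_chart (hM : 0 < M) (hR : IsCritRadius M H R) {p : ℝ × ℝ}
    (hp : p ∈ regionIIprime M R) :
    ∃ (φ : OpenPartialHomeomorph (ℝ × ℝ) (ℝ × ℝ)) (a₁ b₁ a₂ b₂ : ℝ),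
      p ∈ φ.source ∧ φ.target = Ioo a₁ b₁ ×ˢ Ioo a₂ b₂ ∧
      ∀ c ∈ Ioc 0 (kTilde M H R), (tssLeaf M H R c ∩ φ.source).Nonempty →
        ∃ y : ℝ, φ '' (tssLeaf M H R c ∩ φ.source) = Ioo a₁ b₁ ×ˢ {y} := by
  obtain ⟨t₀, x₀, hx₀, rfl⟩ := (mem_regionIIprime hM hR.1.2 p).1 hp
  obtain ⟨ρ₀, h1, h2, -, h3, h4⟩ := exists_graph hR t₀ hx₀.1
  have hρ₀ : ρ₀ ∈ Ioo 0 (2 * M) := ⟨hx₀.1.trans_le h1, (h2 hx₀.2).trans_lt hR.1.2⟩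
  -- an inner leaf that exists at time `t₀`; all leaves outside it exist on a common time interval
  obtain ⟨σ, k1, -, -, k3, k4⟩ := exists_graph hR t₀ (half_pos hx₀.1)
  have hσ : 0 < σ := (half_pos hx₀.1).trans_le k1
  have hσρ : σ < ρ₀ := by
    by_contra! hle
    rcases hle.eq_or_lt with rfl | hlt
    · linarith [hx₀.1]
    · have := (graphRadius_lt hR hρ₀.1 hlt h3).2
      linarith [hx₀.1]
  obtain ⟨a₁, b₁, hab, hsub⟩ :=
    mem_nhds_iff_exists_Ioo_subset.1 ((isOpen_graphDomain hR hσ).mem_nhds k3)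
  have hdom : ∀ t ∈ Ioo a₁ b₁, ∀ ρ ∈ Ioo σ (2 * M), t ∈ graphDomain M H R ρ := fun t ht ρ hρ =>
    (graphRadius_lt hR hσ hρ.1 (hsub ht)).1
  have hrad : ∀ t ∈ Ioo a₁ b₁, ∀ ρ ∈ Ioo σ (2 * M), graphRadius M H R ρ t ∈ Ioo 0 (2 * M) :=
    fun t ht ρ hρ => have h := graphRadius_mem hR (hσ.trans hρ.1) (hdom t ht ρ hρ)
      ⟨h.1, h.2.trans_lt hρ.2⟩
  obtain ⟨e, he, hef⟩ := exists_openPartialHomeomorph_fiber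
    (fun t ρ => kruskalProd M (graphRadius M H R ρ t)) (a₁ := a₁) (b₁ := b₁) (a₂ := σ)
    (b₂ := 2 * M)
    (fun t ht ρ hρ ρ' hρ' hlt => kruskalProd_strictMonoOn hM (hrad t ht ρ hρ).1.le
      (hrad t ht ρ' hρ').1.le (graphRadius_lt hR (hσ.trans hρ.1) hlt (hdom t ht ρ hρ)).2)
    (fun t ht ρ hρ => ((continuous_kruskalProd M).continuousAt.comp
      (continuousAt_graphRadius_leaf hR ⟨hσ.trans hρ.1, hρ.2⟩
        (hdom t ht ρ hρ))).continuousWithinAt)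
    (fun ρ hρ => (continuous_kruskalProd M).comp_continuousOn
      ((contDiffOn_graphRadius hR (hσ.trans hρ.1)).continuousOn.mono fun t ht => hdom t ht ρ hρ))
  set ψ := e.trans (kruskalChart M hM) with hψ
  have hψs : ψ.source = Ioo a₁ b₁ ×ˢ Ioo σ (2 * M) := by
    rw [hψ, OpenPartialHomeomorph.trans_source, he, inter_eq_left]
    intro q hq
    rw [mem_preimage, hef]
    exact ⟨mem_univ _, kruskalProd_neg (hrad q.1 hq.1 q.2 hq.2).2⟩
  have hψf : ∀ q ∈ ψ.source, ψ q = toKruskal M q.1 (graphRadius M H R q.2 q.1) := by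
    intro q hq
    rw [hψs] at hq
    rw [toKruskal_eq hM _ (hrad q.1 hq.1 q.2 hq.2).2, hψ, OpenPartialHomeomorph.coe_trans,
      Function.comp_apply, hef]
  refine ⟨ψ.symm, a₁, b₁, σ, 2 * M, ?_, hψs, fun c hc hne => ?_⟩
  · have hq : (t₀, ρ₀) ∈ ψ.source := by rw [hψs]; exact ⟨hab, hσρ, hρ₀.2⟩
    have := ψ.map_source hq
    rwa [hψf _ hq, h4] at this
  obtain ⟨ρ, hρ, rfl⟩ := hR.exists_kTilde_eq_of_mem_Ioc hc
  have hleaf : ∀ q ∈ ψ.source, ψ q ∈ tssLeaf M H R (kTilde M H ρ) ↔ q.2 = ρ := by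
    intro q hq
    rw [hψf q hq]
    rw [hψs] at hq
    rw [toKruskal_mem_tssLeaf hM hR hρ (hrad q.1 hq.1 q.2 hq.2)]
    constructor
    · rintro ⟨m1, m2⟩
      exact (graph_unique hR hρ.1 (hσ.trans hq.2.1) m1 (hdom q.1 hq.1 q.2 hq.2) m2).symm
    · rintro rfl
      exact ⟨hdom q.1 hq.1 q.2 hq.2, rfl⟩
  refine ⟨ρ, ?_⟩
  have hρσ : ρ ∈ Ioo σ (2 * M) := by
    obtain ⟨z, hz1, hz2⟩ := hne
    have hz := ψ.map_target hz2
    rw [← ψ.right_inv hz2, hleaf _ hz] at hz1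
    rw [hψs] at hz
    exact hz1 ▸ hz.2
  ext q
  constructor
  · rintro ⟨z, ⟨hz1, hz2⟩, rfl⟩
    have hz := ψ.map_target hz2
    rw [← ψ.right_inv hz2, hleaf _ hz] at hz1
    rw [hψs] at hz
    exact ⟨hz.1, hz1⟩
  · rintro ⟨hq1, hq2⟩
    have hq : q ∈ ψ.source := by
      rw [hψs]
      exact ⟨hq1, by rwa [mem_singleton_iff.1 hq2]⟩
    exact ⟨ψ q, ⟨(hleaf q hq).2 hq2, ψ.map_source hq⟩, ψ.left_inv hq⟩

lemma isFoliation_tssLeaf (hM : 0 < M) (hR : IsCritRadius M H R) :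
    IsFoliation (regionIIprime M R) (Ioc 0 (kTilde M H R)) (tssLeaf M H R) where
  connected c hc := by
    obtain ⟨ρ, hρ, rfl⟩ := hR.exists_kTilde_eq_of_mem_Ioc hc
    have hmem : ∀ t ∈ graphDomain M H R ρ, graphRadius M H R ρ t < 2 * M := fun t ht =>
      ((graphRadius_mem hR hρ.1 ht).2.trans hρ.2).trans_lt hR.1.2
    rw [tssLeaf_kTilde hR hρ]
    refine (isConnected_graphDomain hR hρ.1).image _ ?_
    refine ContinuousOn.congr (f := fun t =>
      kruskalChart M hM (t, kruskalProd M (graphRadius M H R ρ t))) ?_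
      fun t ht => toKruskal_eq hM t (hmem t ht)
    exact (kruskalChart M hM).continuousOn.comp (continuousOn_id.prodMk
      ((continuous_kruskalProd M).comp_continuousOn (contDiffOn_graphRadius hR hρ.1).continuousOn))
      fun t ht => ⟨mem_univ _, kruskalProd_neg (hmem t ht)⟩
  disjoint := by
    intro c hc c' hc' hne
    obtain ⟨ρ, hρ, rfl⟩ := hR.exists_kTilde_eq_of_mem_Ioc hc
    obtain ⟨ρ', hρ', rfl⟩ := hR.exists_kTilde_eq_of_mem_Ioc hc'
    refine disjoint_left.2 fun p hp hp' => hne ?_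
    rw [tssLeaf_kTilde hR hρ] at hp
    obtain ⟨t, ht, rfl⟩ := hp
    have hm := graphRadius_mem hR hρ.1 ht
    obtain ⟨h1, h2⟩ := (toKruskal_mem_tssLeaf hM hR hρ'
      ⟨hm.1, (hm.2.trans hρ.2).trans_lt hR.1.2⟩).1 hp'
    rw [graph_unique hR hρ'.1 hρ.1 h1 ht h2]
  cover := by
    ext p
    rw [mem_regionIIprime hM hR.1.2, mem_iUnion₂]
    constructor
    · rintro ⟨c, hc, hp⟩
      obtain ⟨ρ, hρ, rfl⟩ := hR.exists_kTilde_eq_of_mem_Ioc hc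
      rw [tssLeaf_kTilde hR hρ] at hp
      obtain ⟨t, ht, rfl⟩ := hp
      have hm := graphRadius_mem hR hρ.1 ht
      exact ⟨t, _, ⟨hm.1, hm.2.trans hρ.2⟩, rfl⟩
    · rintro ⟨t, r, hr, rfl⟩
      obtain ⟨ρ, h1, h2, -, h3, h4⟩ := exists_graph hR t hr.1
      have hρ : ρ ∈ Ioc 0 R := ⟨hr.1.trans_le h1, h2 hr.2⟩
      have hk : kTilde M H ρ ≤ kTilde M H R :=
        hR.strictMonoOn.monotoneOn (Ioc_subset_Icc_self hρ) ⟨hR.1.1.le, le_rfl⟩ hρ.2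
      exact ⟨kTilde M H ρ, ⟨hR.kTilde_pos hρ, hk⟩,
        (toKruskal_mem_tssLeaf hM hR hρ ⟨hr.1, hr.2.trans_lt hR.1.2⟩).2 ⟨h3, h4⟩⟩
  chart _ hp := exists_foliation_chart hM hR hp

end

theorem mainTheorem3 (M H : ℝ) (hM : 0 < M) :
    ∃ R : ℝ, IsMaxRadius M H R ∧ (∀ R' : ℝ, IsMaxRadius M H R' → R' = R) ∧
      StrictMonoOn (kTilde M H) (Set.Ioc 0 R) ∧
      (∀ c ∈ Set.Ioc 0 (kTilde M H R), IsTSSCMC M H (tssLeaf M H R c)) ∧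
      IsFoliation (regionIIprime M R) (Set.Ioc 0 (kTilde M H R)) (tssLeaf M H R) := by
  obtain ⟨R, hR⟩ : ∃ R, IsCritRadius M H R := exists_cylCurv_eq hM H
  refine ⟨R, hR.isMaxRadius, fun R' h => hR.eq_of_isMaxRadius h,
    hR.strictMonoOn.mono Ioc_subset_Icc_self, fun c hc => ?_, isFoliation_tssLeaf hM hR⟩
  obtain ⟨ρ, hρ, rfl⟩ := hR.exists_kTilde_eq_of_mem_Ioc hc
  exact isTSSCMC_tssLeaf hM hR hρ
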